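/- Identify $\mathbb{R}^8=\mathbb{R}^4\times\mathbb{R}^4=\mathbb{H}^2$ by $a+b\mathbf{i}+c\mathbf{j}+d\mathbf{k}\leftrightarrow(a,b,c,d)$ and write $z=(x,y)$ with $x,y\in\mathbb{R}^4$. Let $B_1,B_2,B_3\in\mathbb{R}^{4\times 4}$ be the matrices of right multiplication on $\mathbb{H}$ by $\mathbf{k},\mathbf{j},-\mathbf{i}$, let $L_{\mathbf{i}},L_{\mathbf{j}},L_{\mathbf{k}}$ be those of left multiplication by $\mathbf{i},\mathbf{j},\mathbf{k}$, and put $$A_i=\begin{pmatrix}0&B_i\\B_i&0\end{pmatrix}\ (i=1,2,3),\quad A_4=\begin{pmatrix}0&I\\-I&0\end{pmatrix},\quad A_5,A_6,A_7=\begin{pmatrix}L_{\mathbf{l}}&0\\0&-L_{\mathbf{l}}\end{pmatrix}\ (\mathbf{l}=\mathbf{i},\mathbf{j},\mathbf{k}).$$ Let $X_i$ be the vector field $X_i(z)=A_iz$ on the unit sphere $\mathbb{S}^7\subset\mathbb{R}^8$, $i=1,\dots,7$, and let $\mathbb{S}^7_T$ be $\mathbb{S}^7$ with the distribution $\mathcal{H}_T=\mathrm{Span}\{X_1,X_2,X_3,X_4\}$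 and the restriction to $\mathcal{H}_T$ of the standard Riemannian metric $\langle\cdot,\cdot\rangle$ of $\mathbb{S}^7$. Recall the Popp measure of a step two subriemannian manifold $(M,\mathcal{H},\langle\cdot,\cdot\rangle)$. The Lie bracket of horizontal vector fields induces, at each $q\in M$, a surjective linear map $\mathcal{H}_q\otimes\mathcal{H}_q\to T_qM/\mathcal{H}_q$. Give $T_qM/\mathcal{H}_q$ the quotient norm $\|u\|=\min\{\|\xi\|:\xi\mapsto u\}$ of the tensor product norm; it is Euclidean. The Popp measure is the smooth measure on $M$ whose density equals $1$ on every basis of $T_qM$ that consists of an orthonormal basis of $\mathcal{H}_q$ followed by representatives of an orthonormal basis of $T_qM/\mathcal{H}_q$. Then $\mathbb{S}^7_T$ is bracket generating of step two, and its Popp measure $\mathcal{P}_T$ is $$\mathcal{P}_T=\left[16\left(1-2\|x\|^2\|y\|^2\right)\right]^{-3/2}d\sigma,\qquad z=(x,y)\in\mathbb{S}^7,$$ where $d\sigma$ is the standard volume on $\mathbb{S}^7$ and $16(1-2\|x\|^2\|y\|^2)>0$ on $\mathbb{S}^7$. Moreover, with $b_{ij}^k(z)=\langle[X_i,X_j](z),X_k(z)\rangle$,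 the $3\times3$ matrix $$B_T(z)=\Big(\sum_{i,j=1}^4b_{ij}^k(z)\,b_{ij}^l(z)\Big)_{k,l=5}^7$$ equals $16(1-2\|x\|^2\|y\|^2)\cdot\mathrm{Id}$ for every $z\in\mathbb{S}^7$. -/

import Mathlib

open scoped Manifold ContDiff Matrix TensorProduct ENNReal Topology
open MeasureTheory VectorField

noncomputable section

/-! ### Subriemannian structures and the Popp measure in step two -/

/-- A smooth distribution `dist` of constant rank `k < n` on an `n`-dimensional manifold `M`
(it is locally spanned by a smooth frame), together with a smooth fibre inner product `metric`.
For the bracket generating condition (in step two) see `SubRiemannian.IsStepTwo`. -/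
structure SubRiemannian (n k : ℕ) (M : Type*) [TopologicalSpace M]
    [ChartedSpace (EuclideanSpace ℝ (Fin n)) M] [IsManifold (𝓡 n) ∞ M] where
  dist : ∀ q : M, Submodule ℝ (TangentSpace (𝓡 n) q)
  metric : ∀ q : M, LinearMap.BilinForm ℝ (dist q)
  rank_lt : k < n
  smooth_dist : ∀ q : M, ∃ U : Set M, IsOpen U ∧ q ∈ U ∧
    ∃ X : Fin k → ∀ p : M, TangentSpace (𝓡 n) p,
      (∀ i, ContMDiffOn (𝓡 n) (𝓡 n).tangent ∞
        (fun p => (⟨p, X i p⟩ : TangentBundle (𝓡 n) M)) U) ∧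
      ∀ p ∈ U, LinearIndependent ℝ (fun i => X i p) ∧
        Submodule.span ℝ (Set.range fun i => X i p) = dist p
  metric_symm : ∀ q v w, metric q v w = metric q w v
  metric_pos : ∀ q v, v ≠ 0 → 0 < metric q v v
  smooth_metric : ∀ (U : Set M) (V W : ∀ p : M, dist p), IsOpen U →
    ContMDiffOn (𝓡 n) (𝓡 n).tangent ∞
      (fun p => (⟨p, (V p : TangentSpace (𝓡 n) p)⟩ : TangentBundle (𝓡 n) M)) U →
    ContMDiffOn (𝓡 n) (𝓡 n).tangent ∞
      (fun p => (⟨p, (W p : TangentSpace (𝓡 n) p)⟩ : TangentBundle (𝓡 n) M)) U →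
    ContMDiffOn (𝓡 n) 𝓘(ℝ, ℝ) ∞ (fun p => metric p (V p) (W p)) U

namespace SubRiemannian

variable {n k : ℕ} {M : Type*} [TopologicalSpace M]
  [ChartedSpace (EuclideanSpace ℝ (Fin n)) M] [IsManifold (𝓡 n) ∞ M]

/-- `V` is a smooth horizontal vector field on `U` (its values outside `U` are irrelevant). -/
def IsHorizontalField (S : SubRiemannian n k M) (U : Set M) (V : ∀ p : M, S.dist p) : Prop :=
  ContMDiffOn (𝓡 n) (𝓡 n).tangent ∞
    (fun p => (⟨p, (V p : TangentSpace (𝓡 n) p)⟩ : TangentBundle (𝓡 n) M)) U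

/-- The Lie bracket `[V, W]` of two horizontal vector fields, at the point `q`. -/
def bracket (S : SubRiemannian n k M) (V W : ∀ p : M, S.dist p) (q : M) : TangentSpace (𝓡 n) q :=
  mlieBracket (𝓡 n) (fun p => (V p : TangentSpace (𝓡 n) p))
    (fun p => (W p : TangentSpace (𝓡 n) p)) q

/-- The structure is bracket generating of step two: `H_q + [H, H]_q = T_q M` at every `q`
(and `H ≠ TM`, because `k < n`). -/
def IsStepTwo (S : SubRiemannian n k M) : Prop :=
  ∀ q : M, S.dist q ⊔ Submodule.span ℝ
    {u | ∃ (U : Set M) (V W : ∀ p : M, S.dist p), IsOpen U ∧ q ∈ U ∧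
      S.IsHorizontalField U V ∧ S.IsHorizontalField U W ∧ u = S.bracket V W q} = ⊤

/-- `β` is the bilinear map `H_q × H_q → T_q M / H_q` induced by the Lie bracket of horizontal
vector fields. -/
def IsBracketMap (S : SubRiemannian n k M) (q : M)
    (β : S.dist q →ₗ[ℝ] S.dist q →ₗ[ℝ] (TangentSpace (𝓡 n) q ⧸ S.dist q)) : Prop :=
  ∀ (U : Set M) (V W : ∀ p : M, S.dist p), IsOpen U → q ∈ U →
    S.IsHorizontalField U V → S.IsHorizontalField U W →
    β (V q) (W q) = (S.dist q).mkQ (S.bracket V W q)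

open Classical in
/-- The bilinear map `H_q × H_q → T_q M / H_q` induced by the Lie bracket. -/
def bracketMap (S : SubRiemannian n k M) (q : M) :
    S.dist q →ₗ[ℝ] S.dist q →ₗ[ℝ] (TangentSpace (𝓡 n) q ⧸ S.dist q) :=
  if h : ∃ β, S.IsBracketMap q β then h.choose else 0

/-- The squared norm on `T_q M / H_q` induced by the surjection `H_q ⊗ H_q → T_q M / H_q`:
the minimum of `‖ξ‖²` over all `ξ ∈ H_q ⊗ H_q` which are mapped to `u`, where `H_q ⊗ H_q` carries
the tensor product inner product. -/
def quotNormSq (S : SubRiemannian n k M) (q : M) (u : TangentSpace (𝓡 n) q ⧸ S.dist q) : ℝ :=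
  sInf {r | ∃ ξ : S.dist q ⊗[ℝ] S.dist q, TensorProduct.lift (S.bracketMap q) ξ = u ∧
    r = LinearMap.BilinForm.tmul (S.metric q) (S.metric q) ξ ξ}

/-- A basis `E` of `T_q M` whose first `k` members are an orthonormal basis of `H_q` and whose
remaining members represent an orthonormal basis of `T_q M / H_q` (that is, they have
`‖∑ c_i [E_i]‖² = ∑ c_i²`). These are the bases that come from orthonormal bases of
`H_q ⊕ T_q M / H_q`. -/
structure IsPoppBasis (S : SubRiemannian n k M) (q : M)
    (E : Module.Basis (Fin n) ℝ (TangentSpace (𝓡 n) q)) : Prop where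
  mem : ∀ i : Fin n, i.val < k → E i ∈ S.dist q
  orthonormal : ∀ (i j : Fin n) (hi : i.val < k) (hj : j.val < k),
    S.metric q ⟨E i, mem i hi⟩ ⟨E j, mem j hj⟩ = if i = j then 1 else 0
  quot : ∀ c : Fin n → ℝ,
    S.quotNormSq q (∑ i with k ≤ i.val, c i • (S.dist q).mkQ (E i)) = ∑ i with k ≤ i.val, c i ^ 2

open Classical in
/-- The Popp density `|ω_q(v_1, …, v_n)|`, where the volume element `ω_q` on `T_q M` is the one
with `|ω_q(E_1, …, E_n)| = 1` for the bases `E` that come from orthonormal bases of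
`H_q ⊕ T_q M / H_q`. (It does not depend on the choice of `E`.) -/
def poppDensity (S : SubRiemannian n k M) (q : M) (v : Fin n → TangentSpace (𝓡 n) q) : ℝ :=
  if h : ∃ E, S.IsPoppBasis q E then |h.choose.det v| else 0

/-- `μ` is the Popp measure: in every smooth chart `φ` it is given by integration of the Popp
density of the coordinate vector fields against Lebesgue measure. -/
def IsPoppMeasure [MeasurableSpace M] (S : SubRiemannian n k M) (μ : Measure M) : Prop :=
  ∀ φ ∈ IsManifold.maximalAtlas (𝓡 n) ∞ M, ∀ s : Set M, MeasurableSet s → s ⊆ φ.source →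
    μ s = ∫⁻ u in φ.target ∩ φ.symm ⁻¹' s, ENNReal.ofReal (S.poppDensity (φ.symm u)
      fun i => mfderiv (𝓡 n) (𝓡 n) φ.symm u (EuclideanSpace.single i (1 : ℝ)))

end SubRiemannian

/-! ### The trivializable structure on the seven-sphere -/

/-- `ℝ⁸ = ℝ⁴ × ℝ⁴ = ℍ²`, a quaternion `a + b i + c j + d k` being identified with
`(a, b, c, d)`. -/
abbrev E8 : Type := EuclideanSpace ℝ (Fin 4 ⊕ Fin 4)

/-- The unit sphere of `ℝ⁸`. -/
abbrev S7 : Type := Metric.sphere (0 : E8) 1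

instance fact_finrank_E8 : Fact (Module.finrank ℝ E8 = 7 + 1) := ⟨by simp⟩

/-- The squared norm of the first component of `z = (x, y) ∈ ℝ⁴ × ℝ⁴`. -/
def normSqX (z : E8) : ℝ := ∑ i : Fin 4, z (Sum.inl i) ^ 2

/-- The squared norm of the second component of `z = (x, y) ∈ ℝ⁴ × ℝ⁴`. -/
def normSqY (z : E8) : ℝ := ∑ i : Fin 4, z (Sum.inr i) ^ 2

/-- Right multiplication by `k`, `j`, `-i` on `ℍ = ℝ⁴`. -/
def rightB : Fin 3 → Matrix (Fin 4) (Fin 4) ℝ :=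
  ![!![0, 0, 0, -1; 0, 0, 1, 0; 0, -1, 0, 0; 1, 0, 0, 0],
    !![0, 0, -1, 0; 0, 0, 0, -1; 1, 0, 0, 0; 0, 1, 0, 0],
    !![0, 1, 0, 0; -1, 0, 0, 0; 0, 0, 0, -1; 0, 0, 1, 0]]

/-- Left multiplication by `i`, `j`, `k` on `ℍ = ℝ⁴`. -/
def leftL : Fin 3 → Matrix (Fin 4) (Fin 4) ℝ :=
  ![!![0, -1, 0, 0; 1, 0, 0, 0; 0, 0, 0, -1; 0, 0, 1, 0],
    !![0, 0, -1, 0; 0, 0, 0, 1; 1, 0, 0, 0; 0, -1, 0, 0],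
    !![0, 0, 0, -1; 0, 0, -1, 0; 0, 1, 0, 0; 1, 0, 0, 0]]

/-- The skew-symmetric anti-commuting matrices `A_1, …, A_7` (indexed from `0` to `6`). -/
def cliffA : Fin 7 → Matrix (Fin 4 ⊕ Fin 4) (Fin 4 ⊕ Fin 4) ℝ :=
  ![Matrix.fromBlocks 0 (rightB 0) (rightB 0) 0,
    Matrix.fromBlocks 0 (rightB 1) (rightB 1) 0,
    Matrix.fromBlocks 0 (rightB 2) (rightB 2) 0,
    Matrix.fromBlocks 0 1 (-1) 0,
    Matrix.fromBlocks (leftL 0) 0 0 (-leftL 0),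
    Matrix.fromBlocks (leftL 1) 0 0 (-leftL 1),
    Matrix.fromBlocks (leftL 2) 0 0 (-leftL 2)]

theorem rightB_transpose (i : Fin 3) : (rightB i)ᵀ = -rightB i := by
  fin_cases i <;> ext a b <;> fin_cases a <;> fin_cases b <;> simp [rightB]

theorem leftL_transpose (i : Fin 3) : (leftL i)ᵀ = -leftL i := by
  fin_cases i <;> ext a b <;> fin_cases a <;> fin_cases b <;> simp [leftL]

theorem rightB_mul_self (i : Fin 3) : rightB i * rightB i = -1 := by
  fin_cases i <;> ext a b <;> fin_cases a <;> fin_cases b <;> simp [rightB]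

theorem rightB_anticomm :
    rightB 1 * rightB 0 = -(rightB 0 * rightB 1) ∧ rightB 2 * rightB 0 = -(rightB 0 * rightB 2) ∧
      rightB 2 * rightB 1 = -(rightB 1 * rightB 2) := by
  refine ⟨?_, ?_, ?_⟩ <;> ext a b <;> fin_cases a <;> fin_cases b <;> simp [rightB]

theorem cliffA_transpose (i : Fin 7) : (cliffA i)ᵀ = -cliffA i := by
  fin_cases i <;> simp [cliffA, Matrix.fromBlocks_transpose, Matrix.fromBlocks_neg,
    rightB_transpose, leftL_transpose]

theorem cliffA_anticomm (i j : Fin 4) :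
    cliffA (Fin.castAdd 3 i) * cliffA (Fin.castAdd 3 j) +
      cliffA (Fin.castAdd 3 j) * cliffA (Fin.castAdd 3 i) = if i = j then -(1 + 1) else 0 := by
  obtain ⟨e1, e2, e3⟩ := rightB_anticomm
  have d := rightB_mul_self
  have h1 : (Matrix.fromBlocks (-(1+1)) 0 0 (-(1+1)) : Matrix (Fin 4 ⊕ Fin 4) (Fin 4 ⊕ Fin 4) ℝ)
      = -(1+1) := by
    rw [← Matrix.fromBlocks_one, Matrix.fromBlocks_add, Matrix.fromBlocks_neg]; simp
  fin_cases i <;> fin_cases j <;>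
    simp [cliffA, Matrix.fromBlocks_multiply, Matrix.fromBlocks_add, d, ← h1, e1, e2, e3]

theorem inner_cliffA_self (i : Fin 7) (z : E8) :
    inner ℝ z ((cliffA i).toEuclideanLin z) = 0 := by
  have h : inner ℝ z ((cliffA i).toEuclideanLin z) = -inner ℝ z ((cliffA i).toEuclideanLin z) := by
    conv_lhs => rw [real_inner_comm]
    simp only [EuclideanSpace.inner_eq_star_dotProduct, Matrix.ofLp_toLpLin, Matrix.toLin'_apply,
      star_trivial]
    rw [Matrix.dotProduct_mulVec, ← Matrix.mulVec_transpose, cliffA_transpose,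
      Matrix.neg_mulVec, neg_dotProduct]
  linarith

theorem inner_cliffA_cliffA (i j : Fin 4) (z : E8) :
    inner ℝ ((cliffA (Fin.castAdd 3 i)).toEuclideanLin z)
      ((cliffA (Fin.castAdd 3 j)).toEuclideanLin z) = if i = j then inner ℝ z z else 0 := by
  have key : ∀ a b : Fin 7, inner ℝ ((cliffA a).toEuclideanLin z) ((cliffA b).toEuclideanLin z) =
      -(z.ofLp ⬝ᵥ ((cliffA a * cliffA b) *ᵥ z.ofLp)) := fun a b => by
    rw [real_inner_comm]
    simp only [EuclideanSpace.inner_eq_star_dotProduct, Matrix.ofLp_toLpLin, Matrix.toLin'_apply,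
      star_trivial]
    rw [← Matrix.mulVec_mulVec, Matrix.dotProduct_mulVec z.ofLp, ← Matrix.mulVec_transpose,
      cliffA_transpose, Matrix.neg_mulVec, neg_dotProduct, neg_neg]
  have hsum : inner ℝ ((cliffA (Fin.castAdd 3 i)).toEuclideanLin z)
      ((cliffA (Fin.castAdd 3 j)).toEuclideanLin z) +
      inner ℝ ((cliffA (Fin.castAdd 3 j)).toEuclideanLin z)
      ((cliffA (Fin.castAdd 3 i)).toEuclideanLin z) =
      -(z.ofLp ⬝ᵥ ((if i = j then -(1 + 1) else 0 : Matrix (Fin 4 ⊕ Fin 4) (Fin 4 ⊕ Fin 4) ℝ)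
        *ᵥ z.ofLp)) := by
    rw [key, key, ← cliffA_anticomm, Matrix.add_mulVec, dotProduct_add]
    ring
  rw [real_inner_comm ((cliffA (Fin.castAdd 3 i)).toEuclideanLin z)] at hsum
  have hz : inner ℝ z z = z.ofLp ⬝ᵥ z.ofLp := EuclideanSpace.inner_eq_star_dotProduct z z
  rw [hz]
  split_ifs at hsum ⊢ with hij
  · rw [Matrix.neg_mulVec, Matrix.add_mulVec, Matrix.one_mulVec, dotProduct_neg,
      dotProduct_add] at hsum
    linarith
  · rw [Matrix.zero_mulVec, dotProduct_zero] at hsum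
    linarith

/-- The differential of the inclusion `S⁷ → ℝ⁸`. -/
def dIncl (z : S7) : TangentSpace (𝓡 7) z →L[ℝ] E8 :=
  mvfderiv (𝓡 7) (Subtype.val : S7 → E8) z

theorem dIncl_injective (z : S7) : Function.Injective (dIncl z) :=
  injective_mvfderiv_subtypeVal_sphere z

/-- The standard Riemannian metric of `S⁷`. -/
def sphereMetric (z : S7) : LinearMap.BilinForm ℝ (TangentSpace (𝓡 7) z) :=
  (innerₗ E8).compl₁₂ (dIncl z : TangentSpace (𝓡 7) z →ₗ[ℝ] E8)
    (dIncl z : TangentSpace (𝓡 7) z →ₗ[ℝ] E8)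

theorem sphereMetric_apply (z : S7) (v w : TangentSpace (𝓡 7) z) :
    sphereMetric z v w = inner ℝ (dIncl z v) (dIncl z w) := rfl

theorem exists_canonicalField (i : Fin 7) (z : S7) :
    ∃ v : TangentSpace (𝓡 7) z, dIncl z v = (cliffA i).toEuclideanLin (z : E8) := by
  have h : (cliffA i).toEuclideanLin (z : E8) ∈ (ℝ ∙ (z : E8))ᗮ :=
    Submodule.mem_orthogonal_singleton_iff_inner_right.2 (inner_cliffA_self i z)
  rw [← range_mvfderiv_subtypeVal (n := 7) z] at h
  exact h

/-- The canonical vector field `X(A_i)` on `S⁷`, whose value at `z` is `A_i z` when tangent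
vectors of `S⁷` are regarded as vectors of `ℝ⁸`. -/
def canonicalField (i : Fin 7) (z : S7) : TangentSpace (𝓡 7) z :=
  (exists_canonicalField i z).choose

theorem dIncl_canonicalField (i : Fin 7) (z : S7) :
    dIncl z (canonicalField i z) = (cliffA i).toEuclideanLin (z : E8) :=
  (exists_canonicalField i z).choose_spec

/-- The distribution `H_T` spanned by `X(A_1), …, X(A_4)`. -/
def distT (z : S7) : Submodule ℝ (TangentSpace (𝓡 7) z) :=
  Submodule.span ℝ (Set.range fun i : Fin 4 => canonicalField (Fin.castAdd 3 i) z)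

/-- The rotation `(t, z) ↦ (cos t) z + (sin t) A_i z`, for `i ≤ 4`, as a map to `ℝ⁸`. -/
def rotE (i : Fin 4) (p : ℝ × S7) : E8 :=
  Real.cos p.1 • (p.2 : E8) + Real.sin p.1 • (cliffA (Fin.castAdd 3 i)).toEuclideanLin (p.2 : E8)

theorem rotE_mem (i : Fin 4) (p : ℝ × S7) : rotE i p ∈ Metric.sphere (0 : E8) 1 := by
  have hz : inner ℝ (p.2 : E8) (p.2 : E8) = 1 := by
    rw [real_inner_self_eq_norm_sq, norm_eq_of_mem_sphere p.2, one_pow]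
  have h1 := inner_cliffA_cliffA i i (p.2 : E8)
  have h2 := inner_cliffA_self (Fin.castAdd 3 i) (p.2 : E8)
  have h3 := h2
  rw [real_inner_comm] at h3
  rw [if_pos rfl, hz] at h1
  have h : ‖rotE i p‖ ^ 2 = 1 := by
    rw [← real_inner_self_eq_norm_sq, rotE]
    simp only [inner_add_left, inner_add_right, real_inner_smul_left, real_inner_smul_right]
    rw [h1, h2, h3, hz]
    have := Real.sin_sq_add_cos_sq p.1
    linarith
  rw [mem_sphere_zero_iff_norm]
  nlinarith [norm_nonneg (rotE i p)]

theorem contMDiff_rotE (i : Fin 4) :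
    ContMDiff (𝓘(ℝ, ℝ).prod (𝓡 7)) 𝓘(ℝ, E8) ∞ (rotE i) := by
  have hc : ContMDiff (𝓘(ℝ, ℝ).prod (𝓡 7)) 𝓘(ℝ, E8) ∞ (fun p : ℝ × S7 => (p.2 : E8)) :=
    contMDiff_coe_sphere.comp contMDiff_snd
  have hA : ContMDiff (𝓘(ℝ, ℝ).prod (𝓡 7)) 𝓘(ℝ, E8) ∞
      (fun p : ℝ × S7 => (cliffA (Fin.castAdd 3 i)).toEuclideanLin (p.2 : E8)) :=
    ((cliffA (Fin.castAdd 3 i)).toEuclideanLin.toContinuousLinearMap.contDiff.contMDiff).comp hc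
  have h1 : ContMDiff (𝓘(ℝ, ℝ).prod (𝓡 7)) 𝓘(ℝ, ℝ) ∞ (fun p : ℝ × S7 => Real.cos p.1) :=
    Real.contDiff_cos.contMDiff.comp contMDiff_fst
  have h2 : ContMDiff (𝓘(ℝ, ℝ).prod (𝓡 7)) 𝓘(ℝ, ℝ) ∞ (fun p : ℝ × S7 => Real.sin p.1) :=
    Real.contDiff_sin.contMDiff.comp contMDiff_fst
  exact (h1.smul hc).add (h2.smul hA)

/-- The rotation `(t, z) ↦ (cos t) z + (sin t) A_i z`, for `i ≤ 4`, as a map to `S⁷`. -/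
def rotS (i : Fin 4) : ℝ × S7 → S7 := Set.codRestrict (rotE i) _ (rotE_mem i)

theorem contMDiff_rotS (i : Fin 4) : ContMDiff (𝓘(ℝ, ℝ).prod (𝓡 7)) (𝓡 7) ∞ (rotS i) :=
  (contMDiff_rotE i).codRestrict_sphere (rotE_mem i)

theorem contMDiff_canonicalField (i : Fin 4) :
    ContMDiff (𝓡 7) (𝓡 7).tangent ∞
      (fun z => (⟨z, canonicalField (Fin.castAdd 3 i) z⟩ : TangentBundle (𝓡 7) S7)) := by
  have h0 : ContMDiff (𝓡 7) 𝓘(ℝ, ℝ).tangent ∞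
      (fun _ : S7 => (⟨0, (1 : ℝ)⟩ : TangentBundle 𝓘(ℝ, ℝ) ℝ)) := contMDiff_const
  have h1 : ContMDiff (𝓡 7) (𝓡 7).tangent ∞
      (fun z : S7 => (⟨z, 0⟩ : TangentBundle (𝓡 7) S7)) := Bundle.contMDiff_zeroSection _ _
  have h2 := (contMDiff_equivTangentBundleProd_symm (n := ∞) (I := 𝓘(ℝ, ℝ)) (M := ℝ)
    (I' := 𝓡 7) (M' := S7)).comp (h0.prodMk h1)
  have h3 := ((contMDiff_rotS i).contMDiff_tangentMap (m := ∞) le_rfl).comp h2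
  have ext_aux : ∀ (z w : S7) (v : TangentSpace (𝓡 7) w), w = z →
      dIncl w v = (cliffA (Fin.castAdd 3 i)).toEuclideanLin (z : E8) →
      (⟨z, canonicalField (Fin.castAdd 3 i) z⟩ : TangentBundle (𝓡 7) S7) = ⟨w, v⟩ := by
    rintro z w v rfl h
    rw [dIncl_injective w (h.trans (dIncl_canonicalField _ w).symm)]
  convert h3 using 1
  ext1 z
  refine ext_aux z _ _ ?_ ?_
  · exact Subtype.ext (by simp [rotS, rotE])
  · let γ : ℝ → ℝ × S7 := fun t => (t, z)
    have dγ : HasMFDerivAt 𝓘(ℝ, ℝ) (𝓘(ℝ, ℝ).prod (𝓡 7)) γ 0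
        ((ContinuousLinearMap.id ℝ ℝ).prod (0 : ℝ →L[ℝ] EuclideanSpace ℝ (Fin 7))) :=
      (hasMFDerivAt_id (I := 𝓘(ℝ, ℝ)) (0 : ℝ)).prodMk (hasMFDerivAt_const z (0 : ℝ))
    have dr := ((contMDiff_rotS i).mdifferentiable (by simp) (γ 0)).hasMFDerivAt
    have dv := ((contMDiff_coe_sphere (E := E8) (n := 7) (m := ∞)).mdifferentiable (by simp)
      (rotS i (γ 0))).hasMFDerivAt
    have d1 := ((dv.comp (γ 0) dr).comp (0 : ℝ) dγ).hasFDerivAt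
    have d2 := ((Real.hasDerivAt_cos 0).smul_const (z : E8)).add
      ((Real.hasDerivAt_sin 0).smul_const ((cliffA (Fin.castAdd 3 i)).toEuclideanLin (z : E8)))
    have aux : ∀ (f : ℝ → E8) (L L' : ℝ →L[ℝ] E8), HasFDerivAt f L 0 → HasFDerivAt f L' 0 →
        L 1 = L' 1 := fun f L L' h h' => by rw [h.unique h']
    refine (aux (fun t => rotE i (t, z)) _ _ d1 d2.hasFDerivAt).trans ?_
    simp

theorem linearIndependent_canonicalField (z : S7) :
    LinearIndependent ℝ (fun i : Fin 4 => canonicalField (Fin.castAdd 3 i) z) := by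
  have hz : inner ℝ (z : E8) (z : E8) = 1 := by
    rw [real_inner_self_eq_norm_sq, norm_eq_of_mem_sphere z, one_pow]
  have : LinearIndependent ℝ
      (fun i : Fin 4 => (cliffA (Fin.castAdd 3 i)).toEuclideanLin (z : E8)) := by
    refine Orthonormal.linearIndependent (𝕜 := ℝ) ?_
    rw [orthonormal_iff_ite]
    intro i j
    rw [inner_cliffA_cliffA, hz]
  refine LinearIndependent.of_comp (dIncl z : TangentSpace (𝓡 7) z →ₗ[ℝ] E8) ?_
  convert this using 1
  ext1 i
  exact dIncl_canonicalField _ z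

theorem contMDiffOn_dIncl (U : Set S7) (V : ∀ z : S7, TangentSpace (𝓡 7) z)
    (hV : ContMDiffOn (𝓡 7) (𝓡 7).tangent ∞ (fun z => (⟨z, V z⟩ : TangentBundle (𝓡 7) S7)) U) :
    ContMDiffOn (𝓡 7) 𝓘(ℝ, E8) ∞ (fun z => dIncl z (V z)) U := by
  have h1 : ContMDiff (𝓡 7).tangent 𝓘(ℝ, E8).tangent ∞
      (tangentMap (𝓡 7) 𝓘(ℝ, E8) (Subtype.val : S7 → E8)) :=
    (contMDiff_coe_sphere (m := ∞)).contMDiff_tangentMap le_rfl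
  exact ((contMDiff_snd_tangentBundle_modelSpace E8 𝓘(ℝ, E8)).comp h1).comp_contMDiffOn hV

/-- The trivializable subriemannian structure on `S⁷`: the distribution spanned by
`X(A_1), …, X(A_4)` with the restriction of the standard Riemannian metric. -/
def S7T : SubRiemannian 7 4 S7 where
  dist := distT
  metric z := (sphereMetric z).restrict (distT z)
  rank_lt := by norm_num
  smooth_dist q := ⟨Set.univ, isOpen_univ, Set.mem_univ q,
    fun i => canonicalField (Fin.castAdd 3 i),
    fun i => (contMDiff_canonicalField i).contMDiffOn,
    fun p _ => ⟨linearIndependent_canonicalField p, rfl⟩⟩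
  metric_symm q v w := by
    simp only [LinearMap.BilinForm.restrict_apply, LinearMap.domRestrict_apply, sphereMetric_apply]
    exact real_inner_comm _ _
  metric_pos q v hv := by
    simp only [LinearMap.BilinForm.restrict_apply, LinearMap.domRestrict_apply, sphereMetric_apply]
    refine real_inner_self_pos.2 fun h => hv ?_
    exact Subtype.ext (dIncl_injective q (h.trans (map_zero _).symm))
  smooth_metric U V W _ hV hW :=
    (contDiff_inner (𝕜 := ℝ) (E := E8)).contMDiff.comp_contMDiffOn
      ((contMDiffOn_dIncl U _ hV).prodMk_space (contMDiffOn_dIncl U _ hW))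

/-- The structure functions `b_{ij}^k(z) = ⟨[X_i, X_j](z), X_k(z)⟩`, for `i, j = 1, …, 4` and
`k = 5, 6, 7` (the indices being counted from `0`). -/
def structB (i j : Fin 4) (k : Fin 3) (z : S7) : ℝ :=
  sphereMetric z
    (mlieBracket (𝓡 7) (canonicalField (Fin.castAdd 3 i)) (canonicalField (Fin.castAdd 3 j)) z)
    (canonicalField (Fin.natAdd 4 k) z)

/-- The matrix `B_T(z)` with entries `B_T^{kl}(z) = ∑_{i,j} b_{ij}^k(z) b_{ij}^l(z)`. -/
def matrixBT (z : S7) : Matrix (Fin 3) (Fin 3) ℝ :=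
  Matrix.of fun k l => ∑ i : Fin 4, ∑ j : Fin 4, structB i j k z * structB i j l z

/-- The standard volume `dσ` on `S⁷`. -/
def sigma7 : Measure S7 := (volume : Measure E8).toSphere

end

/-! The fields `A_1 z, …, A_7 z` form an orthonormal frame of the tangent space at `z`, the first
four spanning `H`. Write λ = `poppFactor z`.

Differentiating `⟨V, A_k p⟩ = 0` for a horizontal field `V`, with `A_k` skew, shows that the `k`-th
vertical component of `[V, W]` is `2 ⟨V, A_k W⟩` (`inner_dIncl_mlieBracket`). So the structure
functions are the quadratic forms `bracketCoeff`. A polynomial identity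
(`sum_bracketCoeff_mul_bracketCoeff_aux`) shows that, as three vectors in `ℝ^{4×4}`, they are
pairwise orthogonal of squared length λ. This is the claim about `B_T`, and since λ > 0 it also
makes the brackets span the quotient `TM/H`.

A linear map from a Euclidean space whose matrix has orthogonal rows of squared length λ induces on
its target the Euclidean norm divided by √λ (`isLeast_norm_lift`). Hence the classes of `√λ A_k z`,
`k = 5, 6, 7`, are orthonormal in the quotient, and a Popp basis has determinant `±λ^{3/2}` in the
orthonormal frame. The Popp density is therefore `λ^{-3/2}` times the Riemannian one
(`poppDensity_eq`).

It remains to see that `sigma7`, defined by volumes of cones, is integration of the Riemannian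
density in every chart (`sigma7_eq_lintegral_chart`). This is the change of variables `(r, u) ↦ r
f(u)`, whose Jacobian is `r^7` times that of the parametrization `f`. -/

noncomputable section

/-! ### Algebra of the matrices `A_i` and the bracket coefficients. -/

/-- The vectors `A_i z`, in coordinates. -/
def cliffVec (z : Fin 4 ⊕ Fin 4 → ℝ) : Fin 7 → Fin 4 ⊕ Fin 4 → ℝ :=
  let x := fun i => z (Sum.inl i)
  let y := fun i => z (Sum.inr i)
  ![Sum.elim ![-y 3, y 2, -y 1, y 0] ![-x 3, x 2, -x 1, x 0],
    Sum.elim ![-y 2, -y 3, y 0, y 1] ![-x 2, -x 3, x 0, x 1],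
    Sum.elim ![y 1, -y 0, -y 3, y 2] ![x 1, -x 0, -x 3, x 2],
    Sum.elim y (-x),
    Sum.elim ![-x 1, x 0, -x 3, x 2] ![y 1, -y 0, y 3, -y 2],
    Sum.elim ![-x 2, x 3, x 0, -x 1] ![y 2, -y 3, -y 0, y 1],
    Sum.elim ![-x 3, -x 2, x 1, x 0] ![y 3, y 2, -y 1, -y 0]]

theorem cliffA_mulVec (i : Fin 7) (z : Fin 4 ⊕ Fin 4 → ℝ) : cliffA i *ᵥ z = cliffVec z i := by
  fin_cases i <;> ext a <;> rcases a with a | a <;> fin_cases a <;>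
    simp [cliffA, cliffVec, rightB, leftL, Matrix.mulVec, dotProduct, Fin.sum_univ_four,
      Matrix.one_apply]

theorem inner_cliffA_eq (i j : Fin 7) (v w : E8) :
    inner ℝ ((cliffA i).toEuclideanLin v) ((cliffA j).toEuclideanLin w) =
      cliffVec v i ⬝ᵥ cliffVec w j := by
  rw [real_inner_comm]
  simp only [EuclideanSpace.inner_eq_star_dotProduct, Matrix.ofLp_toLpLin, Matrix.toLin'_apply,
      star_trivial, cliffA_mulVec]

theorem inner_cliffA_left (i : Fin 7) (v w : E8) :
    inner ℝ ((cliffA i).toEuclideanLin v) w = -inner ℝ v ((cliffA i).toEuclideanLin w) := by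
  simp only [EuclideanSpace.inner_eq_star_dotProduct, Matrix.ofLp_toLpLin, Matrix.toLin'_apply,
    star_trivial]
  rw [Matrix.dotProduct_mulVec, ← Matrix.mulVec_transpose, cliffA_transpose, Matrix.neg_mulVec,
    neg_dotProduct, dotProduct_comm]

/-- Conceptually, the `A_i` are skew, anticommute and square to `-1`. Here each of the 49 pairings
is a quadratic polynomial identity in coordinates. -/
theorem inner_cliffA (i j : Fin 7) (z : E8) :
    inner ℝ ((cliffA i).toEuclideanLin z) ((cliffA j).toEuclideanLin z) =
      if i = j then inner ℝ z z else 0 := by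
  have hz : inner ℝ z z = z.ofLp ⬝ᵥ z.ofLp := EuclideanSpace.inner_eq_star_dotProduct z z
  rw [inner_cliffA_eq, hz]
  generalize z.ofLp = z
  fin_cases i <;> fin_cases j <;>
    (simp only [cliffVec, dotProduct, Fintype.sum_sum_type, Fin.sum_univ_four, Sum.elim_inl,
      Sum.elim_inr, Matrix.cons_val, Pi.neg_apply, Fin.reduceFinMk, Fin.reduceEq, if_true,
      if_false, Fin.zero_eta, Fin.mk_one]
     try ring)

/-- The factor `16 (1 - 2 ‖x‖² ‖y‖²)`. -/
def poppFactor (z : E8) : ℝ := 16 * (1 - 2 * normSqX z * normSqY z)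

/-- The numbers `2 ⟨A_i z, A_k A_j z⟩`. -/
def bracketCoeff (z : E8) (i j : Fin 4) (k : Fin 3) : ℝ :=
  2 * inner ℝ ((cliffA (Fin.castAdd 3 i)).toEuclideanLin z)
    ((cliffA (Fin.natAdd 4 k)).toEuclideanLin ((cliffA (Fin.castAdd 3 j)).toEuclideanLin z))

theorem bracketCoeff_eq (z : E8) (i j : Fin 4) (k : Fin 3) :
    bracketCoeff z i j k = 2 * (cliffVec z (Fin.castAdd 3 i) ⬝ᵥ
      cliffVec (cliffVec z (Fin.castAdd 3 j)) (Fin.natAdd 4 k)) := by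
  rw [bracketCoeff, inner_cliffA_eq]
  simp only [Matrix.ofLp_toLpLin, Matrix.toLin'_apply, cliffA_mulVec]

theorem normSqX_add_normSqY (z : S7) : normSqX z + normSqY z = 1 := by
  have h : inner ℝ (z : E8) (z : E8) = 1 := by
    rw [real_inner_self_eq_norm_sq, norm_eq_of_mem_sphere z, one_pow]
  rw [EuclideanSpace.inner_eq_star_dotProduct] at h
  simpa [dotProduct, normSqX, normSqY, pow_two] using h

/-- Since `‖x‖² + ‖y‖² = 1`, the factor is `8 + 8 (‖x‖² - ‖y‖²)²`, so it is at least 8. -/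
theorem poppFactor_pos (z : S7) : 0 < poppFactor z := by
  have h := normSqX_add_normSqY z
  have : poppFactor z = 8 + 8 * (normSqX z - normSqY z) ^ 2 := by
    have : normSqY z = 1 - normSqX z := by linarith
    rw [poppFactor, this]; ring
  rw [this]
  positivity

/-- The homogenized form: replacing `1` by `(‖x‖² + ‖y‖²)²` makes this a quartic identity on all of
`ℝ⁸`, checked by expansion without the sphere equation. -/
theorem sum_bracketCoeff_mul_bracketCoeff_aux (z : E8) (k l : Fin 3) :
    ∑ i, ∑ j, bracketCoeff z i j k * bracketCoeff z i j l =
      if k = l then 16 * ((normSqX z + normSqY z) ^ 2 - 2 * normSqX z * normSqY z) else 0 := by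
  simp only [bracketCoeff_eq, normSqX, normSqY]
  generalize z.ofLp = z
  fin_cases k <;> fin_cases l <;>
    (simp only [cliffVec, dotProduct, Fintype.sum_sum_type, Fin.sum_univ_four, Sum.elim_inl,
      Sum.elim_inr, Matrix.cons_val, Pi.neg_apply, Fin.reduceFinMk, Fin.reduceEq, if_true,
      if_false, Fin.zero_eta, Fin.mk_one, Fin.reduceCastAdd, Fin.reduceNatAdd]
     try ring)

theorem sum_bracketCoeff_mul_bracketCoeff (z : S7) (k l : Fin 3) :
    ∑ i, ∑ j, bracketCoeff z i j k * bracketCoeff z i j l = if k = l then poppFactor z else 0 := by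
  rw [sum_bracketCoeff_mul_bracketCoeff_aux, normSqX_add_normSqY, one_pow, poppFactor]

/-! ### The orthonormal tangent frame, the distribution and its quotient. -/

theorem inner_cliffA_sphere (z : S7) (i j : Fin 7) :
    inner ℝ ((cliffA i).toEuclideanLin (z : E8)) ((cliffA j).toEuclideanLin (z : E8)) =
      if i = j then 1 else 0 := by
  rw [inner_cliffA, real_inner_self_eq_norm_sq, norm_eq_of_mem_sphere z, one_pow]

theorem linearIndependent_canonicalField_all (z : S7) :
    LinearIndependent ℝ (fun i => canonicalField i z) := by
  refine LinearIndependent.of_comp (dIncl z : TangentSpace (𝓡 7) z →ₗ[ℝ] E8) ?_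
  have h : LinearIndependent ℝ (fun i => (cliffA i).toEuclideanLin (z : E8)) :=
    (orthonormal_iff_ite.2 (inner_cliffA_sphere z)).linearIndependent
  convert h using 1
  ext1 i
  exact dIncl_canonicalField _ z

theorem finrank_tangentSpace_S7 (z : S7) : Module.finrank ℝ (TangentSpace (𝓡 7) z) = 7 :=
  (finrank_euclideanSpace_fin : Module.finrank ℝ (EuclideanSpace ℝ (Fin 7)) = 7)

/-- The basis of `T_z S⁷` given by the canonical vector fields. -/
def tangentBasis (z : S7) : Module.Basis (Fin 7) ℝ (TangentSpace (𝓡 7) z) :=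
  basisOfLinearIndependentOfCardEqFinrank (linearIndependent_canonicalField_all z)
    (by rw [finrank_tangentSpace_S7, Fintype.card_fin])

theorem tangentBasis_apply (z : S7) (i : Fin 7) : tangentBasis z i = canonicalField i z := by
  simp [tangentBasis]

theorem tangentBasis_repr (z : S7) (v : TangentSpace (𝓡 7) z) (i : Fin 7) :
    (tangentBasis z).repr v i = inner ℝ ((cliffA i).toEuclideanLin (z : E8)) (dIncl z v) := by
  conv_rhs => rw [← (tangentBasis z).sum_repr v]
  simp only [map_sum, map_smul, tangentBasis_apply, dIncl_canonicalField, inner_sum,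
    inner_smul_right, inner_cliffA_sphere]
  simp

theorem inner_dIncl (z : S7) (v w : TangentSpace (𝓡 7) z) :
    inner ℝ (dIncl z v) (dIncl z w) =
      ∑ i, (tangentBasis z).repr v i * (tangentBasis z).repr w i := by
  conv_lhs => rw [← (tangentBasis z).sum_repr v]
  simp only [map_sum, map_smul, tangentBasis_apply, dIncl_canonicalField, sum_inner,
    real_inner_smul_left, ← tangentBasis_repr]

theorem sum_fin_seven {G : Type*} [AddCommMonoid G] (f : Fin 7 → G) :
    ∑ i, f i = ∑ i : Fin 4, f (Fin.castAdd 3 i) + ∑ k : Fin 3, f (Fin.natAdd 4 k) :=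
  Fin.sum_univ_add (a := 4) (b := 3) f

theorem mem_distT_iff (z : S7) (v : TangentSpace (𝓡 7) z) :
    v ∈ distT z ↔ ∀ k : Fin 3, (tangentBasis z).repr v (Fin.natAdd 4 k) = 0 := by
  constructor
  · intro hv k
    induction hv using Submodule.span_induction with
    | mem x hx =>
      obtain ⟨i, rfl⟩ := hx
      simp only [← tangentBasis_apply, Module.Basis.repr_self]
      rw [Finsupp.single_eq_of_ne]
      intro h
      have := congrArg Fin.val h
      simp at this
      omega
    | zero => simp
    | add x y _ _ hx hy => simp [hx, hy]
    | smul a x _ hx => simp [hx]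
  · intro h
    rw [← (tangentBasis z).sum_repr v, sum_fin_seven]
    simp only [h, zero_smul, Finset.sum_const_zero, add_zero]
    refine Submodule.sum_mem _ fun i _ => Submodule.smul_mem _ _ ?_
    rw [tangentBasis_apply]
    exact Submodule.subset_span ⟨i, rfl⟩

theorem canonicalField_mem_distT (z : S7) (i : Fin 4) :
    canonicalField (Fin.castAdd 3 i) z ∈ distT z :=
  Submodule.subset_span ⟨i, rfl⟩

/-- The basis of `H_z` given by the first four canonical vector fields. -/
def distBasis (z : S7) : Module.Basis (Fin 4) ℝ (distT z) :=
  Module.Basis.span (linearIndependent_canonicalField z)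

theorem coe_distBasis (z : S7) (i : Fin 4) :
    (distBasis z i : TangentSpace (𝓡 7) z) = canonicalField (Fin.castAdd 3 i) z := by
  simp only [distBasis]
  exact congrArg Subtype.val (Module.Basis.span_apply (linearIndependent_canonicalField z) i)

theorem metric_distBasis (z : S7) (i j : Fin 4) :
    S7T.metric z (distBasis z i) (distBasis z j) = if i = j then 1 else 0 := by
  change inner ℝ (dIncl z (distBasis z i : TangentSpace (𝓡 7) z))
    (dIncl z (distBasis z j : TangentSpace (𝓡 7) z)) = _
  rw [coe_distBasis, coe_distBasis, dIncl_canonicalField, dIncl_canonicalField,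
    inner_cliffA_sphere]
  exact if_congr (Fin.castAdd_injective 4 3).eq_iff rfl rfl

theorem mkQ_eq_sum_of_basis {V : Type*} [AddCommGroup V] [Module ℝ V] (D : Submodule ℝ V)
    (b : Module.Basis (Fin 7) ℝ V) (hb : ∀ i : Fin 4, b (Fin.castAdd 3 i) ∈ D) (v : V) :
    D.mkQ v = ∑ k : Fin 3, b.repr v (Fin.natAdd 4 k) • D.mkQ (b (Fin.natAdd 4 k)) := by
  conv_lhs => rw [← b.sum_repr v, sum_fin_seven]
  simp only [map_add, map_sum, map_smul]
  rw [Finset.sum_eq_zero, zero_add]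
  intro i _
  rw [Submodule.mkQ_apply, (Submodule.Quotient.mk_eq_zero _).2 (hb i), smul_zero]

theorem mkQ_eq_sum (z : S7) (v : TangentSpace (𝓡 7) z) :
    (distT z).mkQ v = ∑ k : Fin 3, (tangentBasis z).repr v (Fin.natAdd 4 k) •
      (distT z).mkQ (canonicalField (Fin.natAdd 4 k) z) := by
  simp only [← tangentBasis_apply]
  refine mkQ_eq_sum_of_basis (distT z) (tangentBasis z) (fun i => ?_) v
  rw [tangentBasis_apply]
  exact canonicalField_mem_distT z i

/-! ### Vertical components of Lie brackets of horizontal fields. -/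

/-- Cartan's formula for the linear one-form `v ↦ ⟨v, A p⟩`, `A` skew, along an immersed
submanifold `g`, evaluated on two vector fields which it annihilates. -/
theorem inner_fderiv_lieBracket_of_skew {E F : Type*} [NormedAddCommGroup E] [NormedSpace ℝ E]
    [NormedAddCommGroup F] [InnerProductSpace ℝ F] {g : E → F} {V W : E → E} {u : E}
    (A : F →L[ℝ] F) (hA : ∀ v w, inner ℝ (A v) w = -inner ℝ v (A w))
    (hg : ContDiffAt ℝ 2 g u) (hV : DifferentiableAt ℝ V u) (hW : DifferentiableAt ℝ W u)
    (hV0 : ∀ᶠ p in 𝓝 u, inner ℝ (fderiv ℝ g p (V p)) (A (g p)) = 0)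
    (hW0 : ∀ᶠ p in 𝓝 u, inner ℝ (fderiv ℝ g p (W p)) (A (g p)) = 0) :
    inner ℝ (fderiv ℝ g u (lieBracket ℝ V W u)) (A (g u)) =
      2 * inner ℝ (fderiv ℝ g u (V u)) (A (fderiv ℝ g u (W u))) := by
  have hdg : DifferentiableAt ℝ g u := hg.differentiableAt (by norm_num)
  have hd2 : DifferentiableAt ℝ (fderiv ℝ g) u :=
    (hg.fderiv_right (m := 1) (by norm_num)).differentiableAt (by norm_num)
  -- The product rule applied to `⟨dg(X), A g⟩ = 0`, in the direction `y`.
  have key : ∀ X : E → E, DifferentiableAt ℝ X u →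
      (∀ᶠ p in 𝓝 u, inner ℝ (fderiv ℝ g p (X p)) (A (g p)) = 0) → ∀ y,
      inner ℝ (fderiv ℝ (fun p => fderiv ℝ g p (X p)) u y) (A (g u)) =
        -inner ℝ (fderiv ℝ g u (X u)) (A (fderiv ℝ g u y)) := by
    intro X hX h0 y
    have h1 : HasFDerivAt (fun p => fderiv ℝ g p (X p)) _ u :=
      (hd2.clm_apply hX).hasFDerivAt
    have h2 : HasFDerivAt (fun p => A (g p)) (A.comp (fderiv ℝ g u)) u :=
      A.hasFDerivAt.comp u hdg.hasFDerivAt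
    have h3 := h1.inner ℝ h2
    have h4 : HasFDerivAt (fun p => inner ℝ (fderiv ℝ g p (X p)) (A (g p)))
        (0 : E →L[ℝ] ℝ) u :=
      (hasFDerivAt_const (0 : ℝ) u).congr_of_eventuallyEq h0
    have h5 := congrArg (fun L : E →L[ℝ] ℝ => L y) (h3.unique h4)
    simp at h5
    linarith
  -- `dg([V, W])` is the derivative of `dg(W)` along `V` minus that of `dg(V)` along `W`. The two
  -- resulting terms coincide because `A` is skew, whence the factor 2.
  rw [fderiv_apply_lieBracket hg (by simp) hW hV, inner_sub_left, key W hW hW0,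
    key V hV hV0]
  rw [← hA, real_inner_comm]
  have := hA (fderiv ℝ g u (V u)) (fderiv ℝ g u (W u))
  linarith

theorem fderiv_coe_comp {f : EuclideanSpace ℝ (Fin 7) → S7} {u : EuclideanSpace ℝ (Fin 7)}
    (hf : MDifferentiableAt (𝓡 7) (𝓡 7) f u) (w : EuclideanSpace ℝ (Fin 7)) :
    fderiv ℝ (fun p => (f p : E8)) u w = dIncl (f u) (mfderiv (𝓡 7) (𝓡 7) f u w) := by
  have h2 : MDifferentiableAt (𝓡 7) 𝓘(ℝ, E8) (Subtype.val : S7 → E8) (f u) :=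
    (contMDiff_coe_sphere (E := E8) (n := 7) (m := ∞)).mdifferentiable (by simp) _
  have h3 := mfderiv_comp_apply u h2 hf w
  rw [mfderiv_eq_fderiv] at h3
  exact h3

/-- `inner_fderiv_lieBracket_of_skew` for `g` the inverse of the chart at `z` followed by the
inclusion, applied to the pulled-back fields. -/
theorem inner_dIncl_mlieBracket (z : S7) (i : Fin 7) (V W : ∀ p : S7, TangentSpace (𝓡 7) p)
    (hV : MDifferentiableAt (𝓡 7) (𝓡 7).tangent
      (fun p => (⟨p, V p⟩ : TangentBundle (𝓡 7) S7)) z)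
    (hW : MDifferentiableAt (𝓡 7) (𝓡 7).tangent
      (fun p => (⟨p, W p⟩ : TangentBundle (𝓡 7) S7)) z)
    (hV0 : ∀ᶠ p : S7 in 𝓝 z, inner ℝ (dIncl p (V p)) ((cliffA i).toEuclideanLin (p : E8)) = 0)
    (hW0 : ∀ᶠ p : S7 in 𝓝 z, inner ℝ (dIncl p (W p)) ((cliffA i).toEuclideanLin (p : E8)) = 0) :
    inner ℝ (dIncl z (mlieBracket (𝓡 7) V W z)) ((cliffA i).toEuclideanLin (z : E8)) =
      2 * inner ℝ (dIncl z (V z)) ((cliffA i).toEuclideanLin (dIncl z (W z))) := by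
  set φ := extChartAt (𝓡 7) z with hφ
  have hr : Set.range (𝓡 7) = Set.univ := (𝓡 7).range_eq_univ
  have hz : φ.symm (φ z) = z := extChartAt_to_inv z
  have hφt : ∀ᶠ u in 𝓝 (φ z), u ∈ φ.target := extChartAt_target_mem_nhds z
  have hmd : ∀ u ∈ φ.target, MDifferentiableAt (𝓡 7) (𝓡 7) φ.symm u := fun u hu => by
    have := mdifferentiableWithinAt_extChartAt_symm (I := 𝓡 7) hu
    rwa [hr, mdifferentiableWithinAt_univ] at this
  have hinv : ∀ u ∈ φ.target, (mfderiv (𝓡 7) (𝓡 7) φ.symm u).IsInvertible := fun u hu => by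
    have := isInvertible_mfderivWithin_extChartAt_symm (I := 𝓡 7) hu
    rwa [hr, mfderivWithin_univ] at this
  let pb : (∀ p : S7, TangentSpace (𝓡 7) p) → EuclideanSpace ℝ (Fin 7) →
    EuclideanSpace ℝ (Fin 7) := fun X => mpullback (𝓡 7) (𝓡 7) φ.symm X
  have hdiff : ∀ X : (∀ p : S7, TangentSpace (𝓡 7) p), MDifferentiableAt (𝓡 7) (𝓡 7).tangent
      (fun p => (⟨p, X p⟩ : TangentBundle (𝓡 7) S7)) z → DifferentiableAt ℝ (pb X) (φ z) := by
    intro X hX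
    have := MDifferentiableWithinAt.differentiableWithinAt_mpullbackWithin_vectorField
      (s := Set.univ) hX.mdifferentiableWithinAt
    rw [hr, mpullbackWithin_univ, Set.preimage_univ, Set.univ_inter] at this
    exact differentiableWithinAt_univ.1 this
  have push : ∀ (X : ∀ p : S7, TangentSpace (𝓡 7) p), ∀ u ∈ φ.target,
      fderiv ℝ (fun p => (φ.symm p : E8)) u (pb X u) = dIncl (φ.symm u) (X (φ.symm u)) := by
    intro X u hu
    rw [fderiv_coe_comp (hmd u hu)]
    refine congrArg (dIncl (φ.symm u)) ?_
    exact (hinv u hu).self_apply_inverse _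
  have hcont : ContinuousAt φ.symm (φ z) := (hmd _ (mem_extChartAt_target z)).continuousAt
  have hperp : ∀ X : (∀ p : S7, TangentSpace (𝓡 7) p), (∀ᶠ p : S7 in 𝓝 z,
      inner ℝ (dIncl p (X p)) ((cliffA i).toEuclideanLin (p : E8)) = 0) →
      ∀ᶠ u in 𝓝 (φ z), inner ℝ (fderiv ℝ (fun p => (φ.symm p : E8)) u (pb X u))
        ((cliffA i).toEuclideanLin.toContinuousLinearMap (φ.symm u : E8)) = 0 := by
    intro X hX
    have : ∀ᶠ u in 𝓝 (φ z), inner ℝ (dIncl (φ.symm u) (X (φ.symm u)))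
        ((cliffA i).toEuclideanLin (φ.symm u : E8)) = 0 := by
      have hX' := hX
      rw [← hz] at hX'
      exact hcont.eventually hX'
    filter_upwards [this, hφt] with u h1 h2
    rw [push X u h2]
    exact h1
  have hg : ContDiffAt ℝ 2 (fun p => (φ.symm p : E8)) (φ z) := by
    have h1 := contMDiffWithinAt_extChartAt_symm_range (I := 𝓡 7) (n := ∞) z
      (mem_extChartAt_target z)
    rw [hr, contMDiffWithinAt_univ] at h1
    exact (((contMDiff_coe_sphere (E := E8) (n := 7) (m := ∞)).contMDiffAt.comp _ h1).contDiffAt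
      ).of_le (by norm_cast)
  have key := inner_fderiv_lieBracket_of_skew (cliffA i).toEuclideanLin.toContinuousLinearMap
    (inner_cliffA_left i) hg (hdiff V hV) (hdiff W hW) (hperp V hV0) (hperp W hW0)
  rw [push V _ (mem_extChartAt_target z), push W _ (mem_extChartAt_target z)] at key
  -- The preferred chart at `z` has identity differential at `z`, so the manifold bracket there is
  -- the flat bracket of the pulled-back fields.
  have hbr : fderiv ℝ (fun p => (φ.symm p : E8)) (φ z) (lieBracket ℝ (pb V) (pb W) (φ z)) =
      dIncl z (mlieBracket (𝓡 7) V W z) := by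
    have hB : mlieBracket (𝓡 7) V W z = lieBracket ℝ (pb V) (pb W) (φ z) := by
      rw [mlieBracket, mlieBracketWithin_apply, mfderiv_extChartAt_self, hr, mpullbackWithin_univ,
        mpullbackWithin_univ, Set.preimage_univ, Set.univ_inter]
      exact (congrArg (fun L : EuclideanSpace ℝ (Fin 7) →L[ℝ] EuclideanSpace ℝ (Fin 7) =>
        L (lieBracketWithin ℝ (pb V) (pb W) Set.univ (φ z)))
        ContinuousLinearMap.inverse_id).trans (congrFun lieBracketWithin_univ _)
    have hid := mfderivWithin_range_extChartAt_symm (I := 𝓡 7) (x := z)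
    rw [hr, mfderivWithin_univ] at hid
    rw [fderiv_coe_comp (hmd _ (mem_extChartAt_target z)), hB]
    -- The base point `φ.symm (φ z)` is only provably equal to `z`. Every tangent space has the
    -- model space as its underlying type, so the vectors can still be compared.
    have hcast : ∀ (p : S7) (w w' : EuclideanSpace ℝ (Fin 7)), p = z → w = w' →
        dIncl p w = dIncl z w' := by
      rintro p w w' rfl rfl
      rfl
    refine hcast _ _ _ hz ?_
    exact congrArg (fun L : EuclideanSpace ℝ (Fin 7) →L[ℝ] EuclideanSpace ℝ (Fin 7) =>
      L (lieBracket ℝ (pb V) (pb W) (φ z))) hid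
  rw [hbr] at key
  rwa [hz] at key

theorem inner_dIncl_of_mem_distT {z : S7} {v : TangentSpace (𝓡 7) z} (hv : v ∈ distT z)
    (k : Fin 3) : inner ℝ (dIncl z v) ((cliffA (Fin.natAdd 4 k)).toEuclideanLin (z : E8)) = 0 := by
  rw [real_inner_comm, ← tangentBasis_repr]
  exact (mem_distT_iff z v).1 hv k

/-- Only the values of `V` and `W` at `z` enter: this is the tensoriality that makes the induced
bracket form well defined. -/
theorem repr_mlieBracket {z : S7} {V W : ∀ p : S7, TangentSpace (𝓡 7) p} {U : Set S7}
    (hU : IsOpen U) (hz : z ∈ U) (hVd : ∀ p, V p ∈ distT p) (hWd : ∀ p, W p ∈ distT p)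
    (hV : ContMDiffOn (𝓡 7) (𝓡 7).tangent ∞
      (fun p => (⟨p, V p⟩ : TangentBundle (𝓡 7) S7)) U)
    (hW : ContMDiffOn (𝓡 7) (𝓡 7).tangent ∞
      (fun p => (⟨p, W p⟩ : TangentBundle (𝓡 7) S7)) U) (k : Fin 3) :
    (tangentBasis z).repr (mlieBracket (𝓡 7) V W z) (Fin.natAdd 4 k) =
      2 * inner ℝ (dIncl z (V z))
        ((cliffA (Fin.natAdd 4 k)).toEuclideanLin (dIncl z (W z))) := by
  rw [tangentBasis_repr, real_inner_comm]
  exact inner_dIncl_mlieBracket z _ V W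
    ((hV.contMDiffAt (hU.mem_nhds hz)).mdifferentiableAt (by simp))
    ((hW.contMDiffAt (hU.mem_nhds hz)).mdifferentiableAt (by simp))
    (Filter.Eventually.of_forall fun p => inner_dIncl_of_mem_distT (hVd p) k)
    (Filter.Eventually.of_forall fun p => inner_dIncl_of_mem_distT (hWd p) k)

theorem repr_mlieBracket_canonicalField (z : S7) (i j : Fin 4) (k : Fin 3) :
    (tangentBasis z).repr (mlieBracket (𝓡 7) (canonicalField (Fin.castAdd 3 i))
      (canonicalField (Fin.castAdd 3 j)) z) (Fin.natAdd 4 k) = bracketCoeff z i j k := by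
  rw [repr_mlieBracket isOpen_univ (Set.mem_univ z) (fun p => canonicalField_mem_distT p i)
    (fun p => canonicalField_mem_distT p j) (contMDiff_canonicalField i).contMDiffOn
    (contMDiff_canonicalField j).contMDiffOn, dIncl_canonicalField, dIncl_canonicalField]
  rfl

theorem structB_eq (z : S7) (i j : Fin 4) (k : Fin 3) :
    structB i j k z = bracketCoeff z i j k := by
  rw [structB, sphereMetric_apply, dIncl_canonicalField, real_inner_comm, ← tangentBasis_repr,
    repr_mlieBracket_canonicalField]

/-! ### The induced bracket form and the step two condition. -/

/-- The canonical field `X(A_i)`, `i ≤ 4`, as a horizontal field. -/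
def horizontalField (i : Fin 4) (p : S7) : S7T.dist p :=
  ⟨canonicalField (Fin.castAdd 3 i) p, canonicalField_mem_distT p i⟩

theorem isHorizontalField_horizontalField (i : Fin 4) :
    S7T.IsHorizontalField Set.univ (horizontalField i) :=
  (contMDiff_canonicalField i).contMDiffOn

/-- The bilinear map `H_z × H_z → T_z S⁷ / H_z` induced by the Lie bracket. -/
def bracketForm (z : S7) :
    S7T.dist z →ₗ[ℝ] S7T.dist z →ₗ[ℝ] (TangentSpace (𝓡 7) z ⧸ S7T.dist z) :=
  ∑ k : Fin 3, ((2 : ℝ) • (innerₗ E8).compl₁₂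
    ((dIncl z : TangentSpace (𝓡 7) z →ₗ[ℝ] E8).comp (S7T.dist z).subtype)
    ((cliffA (Fin.natAdd 4 k)).toEuclideanLin.comp
      ((dIncl z : TangentSpace (𝓡 7) z →ₗ[ℝ] E8).comp (S7T.dist z).subtype))).compr₂
    (LinearMap.toSpanSingleton ℝ (TangentSpace (𝓡 7) z ⧸ S7T.dist z)
      ((S7T.dist z).mkQ (canonicalField (Fin.natAdd 4 k) z)))

theorem bracketForm_apply (z : S7) (v w : S7T.dist z) :
    bracketForm z v w = ∑ k : Fin 3, (2 * inner ℝ (dIncl z (v : TangentSpace (𝓡 7) z))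
      ((cliffA (Fin.natAdd 4 k)).toEuclideanLin (dIncl z (w : TangentSpace (𝓡 7) z)))) •
      (S7T.dist z).mkQ (canonicalField (Fin.natAdd 4 k) z) := by
  simp only [bracketForm, LinearMap.sum_apply]
  rfl

/-- Guarantees that `bracketMap` is a genuine bracket form and not its default value 0. -/
theorem isBracketMap_bracketForm (z : S7) : S7T.IsBracketMap z (bracketForm z) := by
  intro U V W hU hz hV hW
  rw [bracketForm_apply]
  refine Eq.trans ?_ (mkQ_eq_sum z _).symm
  refine Finset.sum_congr rfl fun k _ => ?_
  rw [SubRiemannian.bracket, repr_mlieBracket hU hz (fun p => (V p).2) (fun p => (W p).2) hV hW]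
  rfl

/-- `bracketMap` is a chosen form, so it is evaluated through its defining property, tested on the
globally smooth fields `horizontalField`. -/
theorem bracketMap_distBasis (z : S7) (i j : Fin 4) :
    S7T.bracketMap z (distBasis z i) (distBasis z j) = ∑ k : Fin 3, bracketCoeff z i j k •
      (distT z).mkQ (canonicalField (Fin.natAdd 4 k) z) := by
  have hex : ∃ β, S7T.IsBracketMap z β := ⟨_, isBracketMap_bracketForm z⟩
  have hb : ∀ i, distBasis z i = horizontalField i z := fun i => Subtype.ext (coe_distBasis z i)
  rw [SubRiemannian.bracketMap, dif_pos hex, hb, hb]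
  refine (hex.choose_spec Set.univ _ _ isOpen_univ (Set.mem_univ z)
    (isHorizontalField_horizontalField i) (isHorizontalField_horizontalField j)).trans ?_
  refine (mkQ_eq_sum z _).trans (Finset.sum_congr rfl fun k _ => ?_)
  exact congrArg (fun c : ℝ => c • (distT z).mkQ (canonicalField (Fin.natAdd 4 k) z))
    (repr_mlieBracket_canonicalField z i j k)

theorem isStepTwo_S7T : S7T.IsStepTwo := by
  intro z
  set T : Submodule ℝ (TangentSpace (𝓡 7) z) := S7T.dist z ⊔ Submodule.span ℝ
    {u | ∃ (U : Set S7) (V W : ∀ p : S7, S7T.dist p), IsOpen U ∧ z ∈ U ∧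
      S7T.IsHorizontalField U V ∧ S7T.IsHorizontalField U W ∧ u = S7T.bracket V W z} with hT
  have hdist : distT z ≤ T := le_sup_left
  have hbr : ∀ i j : Fin 4, mlieBracket (𝓡 7) (canonicalField (Fin.castAdd 3 i))
      (canonicalField (Fin.castAdd 3 j)) z ∈ T := fun i j =>
    le_sup_right (α := Submodule ℝ (TangentSpace (𝓡 7) z)) (Submodule.subset_span
      ⟨Set.univ, horizontalField i, horizontalField j, isOpen_univ, Set.mem_univ z,
        isHorizontalField_horizontalField i, isHorizontalField_horizontalField j, rfl⟩)
  have hk : ∀ k : Fin 3, canonicalField (Fin.natAdd 4 k) z ∈ T := by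
    intro k
    -- Weighting the brackets by their own `k`-th components isolates the direction `k`: by the
    -- orthogonality relations, `w` equals λ `X_k` modulo `H`, and λ ≠ 0.
    set w : TangentSpace (𝓡 7) z := ∑ i, ∑ j, bracketCoeff z i j k •
      mlieBracket (𝓡 7) (canonicalField (Fin.castAdd 3 i))
        (canonicalField (Fin.castAdd 3 j)) z with hw
    have hwT : w ∈ T := Submodule.sum_mem _ fun i _ => Submodule.sum_mem _ fun j _ =>
      Submodule.smul_mem _ _ (hbr i j)
    have hd : w - poppFactor z • canonicalField (Fin.natAdd 4 k) z ∈ distT z := by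
      rw [mem_distT_iff]
      intro l
      have hwl : (tangentBasis z).repr w (Fin.natAdd 4 l) = if k = l then poppFactor z else 0 := by
        rw [← sum_bracketCoeff_mul_bracketCoeff]
        simp only [hw, map_sum, map_smul, Finsupp.coe_finsetSum, Finset.sum_apply,
          Finsupp.smul_apply, repr_mlieBracket_canonicalField, smul_eq_mul]
      rw [map_sub, map_smul, ← tangentBasis_apply, Module.Basis.repr_self, Finsupp.sub_apply, hwl,
        Finsupp.smul_apply, Finsupp.single_apply]
      have hkl : Fin.natAdd 4 k = Fin.natAdd 4 l ↔ k = l := (Fin.natAdd_injective 3 4).eq_iff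
      simp [hkl]
    have hs := T.sub_mem hwT (hdist hd)
    rw [sub_sub_cancel] at hs
    exact (Submodule.smul_mem_iff _ (poppFactor_pos z).ne').1 hs
  rw [eq_top_iff, ← (tangentBasis z).span_eq, Submodule.span_le]
  rintro _ ⟨a, rfl⟩
  rw [tangentBasis_apply]
  refine Fin.addCases (m := 4) (n := 3) (motive := fun a => canonicalField a z ∈ T)
    (fun i => hdist (canonicalField_mem_distT z i)) hk a

/-! ### The quotient norm and the linear algebra around it. -/

theorem bilinForm_tmul_sum_smul {H ι : Type*} [Fintype ι] [DecidableEq ι] [AddCommGroup H]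
    [Module ℝ H] (b : ι → H) (B : LinearMap.BilinForm ℝ H)
    (hB : ∀ i j, B (b i) (b j) = if i = j then 1 else 0) (c : ι × ι → ℝ) :
    LinearMap.BilinForm.tmul B B (∑ p, c p • b p.1 ⊗ₜ[ℝ] b p.2) (∑ p, c p • b p.1 ⊗ₜ[ℝ] b p.2) =
      ∑ p, c p ^ 2 := by
  simp only [map_sum, map_smul, LinearMap.sum_apply, LinearMap.smul_apply,
    LinearMap.BilinForm.tensorDistrib_tmul, hB, smul_eq_mul]
  refine Finset.sum_congr rfl fun p _ => ?_
  rw [Finset.sum_eq_single p]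
  · simp [pow_two]
  · intro q _ hq
    by_cases h : q.1 = p.1
    · have h' : q.2 ≠ p.2 := fun h' => hq (Prod.ext h h')
      simp [h, h']
    · simp [h]
  · simp

/-- The quotient norm of a surjection `H ⊗ H → Q` whose matrix with respect to orthonormal bases
has orthogonal rows of equal length. -/
theorem isLeast_norm_lift {H Q ι κ : Type*} [Fintype ι] [DecidableEq ι] [Fintype κ]
    [DecidableEq κ] [AddCommGroup H] [Module ℝ H] [AddCommGroup Q] [Module ℝ Q]
    (b : Module.Basis ι ℝ H) (B : LinearMap.BilinForm ℝ H)
    (hB : ∀ i j, B (b i) (b j) = if i = j then 1 else 0) (β : H →ₗ[ℝ] H →ₗ[ℝ] Q) {f : κ → Q}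
    (hf : LinearIndependent ℝ f) (s : ι → ι → κ → ℝ)
    (hβ : ∀ i j, β (b i) (b j) = ∑ k, s i j k • f k) {c : ℝ} (hc : 0 < c)
    (hs : ∀ k l, ∑ i, ∑ j, s i j k * s i j l = if k = l then c else 0) (d : κ → ℝ) :
    IsLeast {r | ∃ ξ : H ⊗[ℝ] H, TensorProduct.lift β ξ = ∑ k, d k • f k ∧
      r = LinearMap.BilinForm.tmul B B ξ ξ} ((∑ k, d k ^ 2) / c) := by
  have hlift : ∀ x : ι × ι → ℝ, TensorProduct.lift β (∑ p, x p • b p.1 ⊗ₜ[ℝ] b p.2) =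
      ∑ k, (∑ p, x p * s p.1 p.2 k) • f k := by
    intro x
    simp only [map_sum, map_smul, TensorProduct.lift.tmul, hβ, Finset.smul_sum, Finset.sum_smul,
      smul_smul]
    exact Finset.sum_comm
  have hs' : ∀ k l, ∑ p : ι × ι, s p.1 p.2 k * s p.1 p.2 l = if k = l then c else 0 := fun k l => by
    rw [← hs, Fintype.sum_prod_type]
  have hS : ∀ k, ∑ p : ι × ι, (∑ l, d l * s p.1 p.2 l) * s p.1 p.2 k = c * d k := by
    intro k
    simp only [Finset.sum_mul, mul_assoc]
    rw [Finset.sum_comm]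
    simp only [← Finset.mul_sum, hs']
    simp [mul_comm]
  have hSS : ∑ p : ι × ι, (∑ l, d l * s p.1 p.2 l) ^ 2 = c * ∑ k, d k ^ 2 := by
    have : ∀ p : ι × ι, (∑ l, d l * s p.1 p.2 l) ^ 2 =
        ∑ k, d k * ((∑ l, d l * s p.1 p.2 l) * s p.1 p.2 k) := fun p => by
      rw [pow_two, Finset.mul_sum]
      exact Finset.sum_congr rfl fun k _ => by ring
    simp only [this]
    rw [Finset.sum_comm]
    simp only [← Finset.mul_sum, hS]
    rw [Finset.mul_sum]
    exact Finset.sum_congr rfl fun k _ => by ring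
  constructor
  -- The minimizer is the preimage lying in the span of the rows of `s`, hence orthogonal to the
  -- kernel.
  · refine ⟨∑ p : ι × ι, ((∑ l, d l * s p.1 p.2 l) / c) • b p.1 ⊗ₜ[ℝ] b p.2, ?_, ?_⟩
    · rw [hlift]
      refine Finset.sum_congr rfl fun k _ => ?_
      congr 1
      simp only [div_mul_eq_mul_div, ← Finset.sum_div, hS]
      field_simp
    · rw [bilinForm_tmul_sum_smul b B hB]
      simp only [div_pow, ← Finset.sum_div, hSS]
      field_simp
  · rintro r ⟨ξ, hξ, rfl⟩
    obtain ⟨x, rfl⟩ : ∃ x : ι × ι → ℝ, ξ = ∑ p, x p • b p.1 ⊗ₜ[ℝ] b p.2 :=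
      ⟨(b.tensorProduct b).repr ξ, by
        conv_lhs => rw [← (b.tensorProduct b).sum_repr ξ]
        simp only [Module.Basis.tensorProduct_apply']⟩
    rw [hlift] at hξ
    have hd : ∀ k, ∑ p, x p * s p.1 p.2 k = d k := fun k => by
      have h0 : ∑ k, (∑ p, x p * s p.1 p.2 k - d k) • f k = 0 := by
        simp only [sub_smul, Finset.sum_sub_distrib, hξ, sub_self]
      have := Fintype.linearIndependent_iff.1 hf _ h0 k
      linarith
    rw [bilinForm_tmul_sum_smul b B hB]
    -- Pythagoras: the squared distance from any preimage to the minimizer is `∑ x_p² - (∑ d_k²) /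
    -- c`.
    have h1 : 0 ≤ ∑ p : ι × ι, (x p - (∑ l, d l * s p.1 p.2 l) / c) ^ 2 :=
      Finset.sum_nonneg fun _ _ => sq_nonneg _
    have h2 : ∑ p : ι × ι, x p * (∑ l, d l * s p.1 p.2 l) = ∑ k, d k ^ 2 := by
      simp only [Finset.mul_sum]
      rw [Finset.sum_comm]
      refine Finset.sum_congr rfl fun k _ => ?_
      rw [pow_two]
      nth_rewrite 2 [← hd k]
      rw [Finset.sum_mul]
      exact Finset.sum_congr rfl fun p _ => by ring
    have h3 : ∑ p : ι × ι, (x p - (∑ l, d l * s p.1 p.2 l) / c) ^ 2 =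
        ∑ p, x p ^ 2 - 2 / c * ∑ p : ι × ι, x p * (∑ l, d l * s p.1 p.2 l) +
          1 / c ^ 2 * ∑ p : ι × ι, (∑ l, d l * s p.1 p.2 l) ^ 2 := by
      rw [Finset.mul_sum, Finset.mul_sum, ← Finset.sum_sub_distrib, ← Finset.sum_add_distrib]
      exact Finset.sum_congr rfl fun p _ => by field_simp; ring
    rw [h3, h2, hSS] at h1
    have h4 : 1 / c ^ 2 * (c * ∑ k, d k ^ 2) = (∑ k, d k ^ 2) / c := by field_simp
    have h5 : 2 / c * ∑ k, d k ^ 2 = 2 * ((∑ k, d k ^ 2) / c) := by ring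
    rw [h4, h5] at h1
    linarith

/-- Polarization: a matrix scaling all squared lengths by `r` scales all inner products by `r`. -/
theorem transpose_mul_self_of_forall_sum_sq {ι : Type*} [Fintype ι] [DecidableEq ι]
    (R : Matrix ι ι ℝ) (r : ℝ) (h : ∀ c : ι → ℝ, ∑ k, (∑ j, R k j * c j) ^ 2 = r * ∑ j, c j ^ 2) :
    Rᵀ * R = r • (1 : Matrix ι ι ℝ) := by
  have key : ∀ c d : ι → ℝ, ∑ k, (∑ j, R k j * c j) * (∑ j, R k j * d j) =
      r * ∑ j, c j * d j := by
    intro c d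
    have h1 := h (c + d)
    simp only [Pi.add_apply, mul_add, Finset.sum_add_distrib, add_sq, h c, h d] at h1
    simp only [mul_assoc, ← Finset.mul_sum] at h1
    linarith
  ext i j
  have := key (Pi.single i 1) (Pi.single j 1)
  simp only [Pi.single_apply, mul_ite, mul_one, mul_zero, Finset.sum_ite_eq', Finset.mem_univ,
    if_true] at this
  rw [Matrix.mul_apply, Matrix.smul_apply, Matrix.one_apply]
  simp only [Matrix.transpose_apply, this, eq_comm (a := j)]
  simp

theorem det_sq_of_transpose_mul_self {ι : Type*} [Fintype ι] [DecidableEq ι]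
    {R : Matrix ι ι ℝ} {r : ℝ} (h : Rᵀ * R = r • (1 : Matrix ι ι ℝ)) :
    R.det ^ 2 = r ^ Fintype.card ι := by
  have := congrArg Matrix.det h
  rwa [Matrix.det_mul, Matrix.det_transpose, Matrix.det_smul, Matrix.det_one, mul_one,
    ← pow_two] at this

theorem linearIndependent_mkQ_canonicalField (z : S7) : LinearIndependent ℝ
    fun k : Fin 3 => (distT z).mkQ (canonicalField (Fin.natAdd 4 k) z) := by
  rw [Fintype.linearIndependent_iff]
  intro g hg k
  have h1 : (∑ k : Fin 3, g k • canonicalField (Fin.natAdd 4 k) z) ∈ distT z := by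
    rw [← (Submodule.Quotient.mk_eq_zero (distT z)), ← Submodule.mkQ_apply, map_sum, ← hg]
    exact Finset.sum_congr rfl fun k _ => map_smul _ _ _
  have h2 := (mem_distT_iff z _).1 h1 k
  have hkl : ∀ l, Fin.natAdd 4 l = Fin.natAdd 4 k ↔ l = k := fun l =>
    (Fin.natAdd_injective 3 4).eq_iff
  simpa [← tangentBasis_apply, Finsupp.single_apply, hkl] using h2

theorem quotNormSq_sum (z : S7) (d : Fin 3 → ℝ) :
    S7T.quotNormSq z (∑ k, d k • (distT z).mkQ (canonicalField (Fin.natAdd 4 k) z)) =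
      (∑ k, d k ^ 2) / poppFactor z :=
  (isLeast_norm_lift (distBasis z) (S7T.metric z) (metric_distBasis z) (S7T.bracketMap z)
    (linearIndependent_mkQ_canonicalField z) (bracketCoeff z) (bracketMap_distBasis z)
    (poppFactor_pos z) (sum_bracketCoeff_mul_bracketCoeff z) d).csInf_eq

theorem quotNormSq_mkQ (z : S7) (v : TangentSpace (𝓡 7) z) :
    S7T.quotNormSq z ((distT z).mkQ v) =
      (∑ k : Fin 3, (tangentBasis z).repr v (Fin.natAdd 4 k) ^ 2) / poppFactor z := by
  rw [mkQ_eq_sum]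
  exact quotNormSq_sum z _

/-! ### Popp bases and the Popp density. -/

theorem sum_filter_four_le {G : Type*} [AddCommMonoid G] (f : Fin 7 → G) :
    ∑ i with 4 ≤ i.val, f i = ∑ k : Fin 3, f (Fin.natAdd 4 k) := by
  have h : ∀ i : Fin 4, ¬ 4 ≤ (i : ℕ) := fun i => i.2.not_ge
  rw [Finset.sum_filter, sum_fin_seven]
  simp [h]

/-- In the orthonormal frame a Popp basis is block upper triangular. The 4×4 block `P` is orthogonal
and the 3×3 block satisfies `RᵀR = λ`. Holding for every Popp basis, this covers the one chosen in
`poppDensity`. -/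
theorem sq_det_tangentBasis_of_isPoppBasis {z : S7}
    {E : Module.Basis (Fin 7) ℝ (TangentSpace (𝓡 7) z)} (hE : S7T.IsPoppBasis z E) :
    (tangentBasis z).det E ^ 2 = poppFactor z ^ 3 := by
  set M : Fin 7 → Fin 7 → ℝ := fun a i => (tangentBasis z).repr (E i) a with hM
  set P : Matrix (Fin 4) (Fin 4) ℝ :=
    Matrix.of fun a i => M (Fin.castAdd 3 a) (Fin.castAdd 3 i) with hP
  set R : Matrix (Fin 3) (Fin 3) ℝ :=
    Matrix.of fun a i => M (Fin.natAdd 4 a) (Fin.natAdd 4 i) with hR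
  have hmem : ∀ i : Fin 4, E (Fin.castAdd 3 i) ∈ distT z := fun i => hE.mem _ i.2
  have h0 : ∀ (k : Fin 3) (i : Fin 4), M (Fin.natAdd 4 k) (Fin.castAdd 3 i) = 0 := fun k i =>
    (mem_distT_iff z _).1 (hmem i) k
  have hdet : (tangentBasis z).det E = P.det * R.det := by
    rw [Module.Basis.det_apply, ← Matrix.det_submatrix_equiv_self (finSumFinEquiv (m := 4) (n := 3)),
      ← Matrix.det_fromBlocks_zero₂₁ P
        (Matrix.of fun a k => M (Fin.castAdd 3 a) (Fin.natAdd 4 k)) R]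
    congr 1
    ext a i
    rcases a with a | a <;> rcases i with i | i
    · rfl
    · rfl
    · exact h0 a i
    · rfl
  have hPP : Pᵀ * P = (1 : ℝ) • (1 : Matrix (Fin 4) (Fin 4) ℝ) := by
    ext i j
    have h1 := hE.orthonormal (Fin.castAdd 3 i) (Fin.castAdd 3 j) i.2 j.2
    change inner ℝ (dIncl z (E (Fin.castAdd 3 i))) (dIncl z (E (Fin.castAdd 3 j))) = _ at h1
    rw [inner_dIncl, sum_fin_seven] at h1
    have h2 : ∀ k, (tangentBasis z).repr (E (Fin.castAdd 3 i)) (Fin.natAdd 4 k) = 0 :=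
      fun k => h0 k i
    simp only [h2, zero_mul, Finset.sum_const_zero, add_zero] at h1
    rw [one_smul, Matrix.mul_apply, Matrix.one_apply]
    refine h1.trans (if_congr (Fin.castAdd_injective 4 3).eq_iff rfl rfl)
  have hRR : Rᵀ * R = poppFactor z • (1 : Matrix (Fin 3) (Fin 3) ℝ) := by
    refine transpose_mul_self_of_forall_sum_sq R _ fun c => ?_
    -- The first four coefficients do not enter the filtered sums and are set to 0.
    have h1 := hE.quot (Fin.append 0 c)
    rw [sum_filter_four_le, sum_filter_four_le] at h1
    have h2 : ∑ k : Fin 3, (Fin.append (0 : Fin 4 → ℝ) c) (Fin.natAdd 4 k) •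
        (S7T.dist z).mkQ (E (Fin.natAdd 4 k)) =
        (distT z).mkQ (∑ k : Fin 3, c k • E (Fin.natAdd 4 k)) := by
      rw [map_sum]
      refine Finset.sum_congr rfl fun k _ => ?_
      rw [map_smul, Fin.append_right]
      rfl
    rw [h2, quotNormSq_mkQ, div_eq_iff (poppFactor_pos z).ne'] at h1
    simp only [Fin.append_right] at h1
    rw [mul_comm, ← h1]
    refine Finset.sum_congr rfl fun k _ => ?_
    congr 1
    rw [map_sum, Finsupp.coe_finsetSum, Finset.sum_apply]
    refine Finset.sum_congr rfl fun j _ => ?_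
    rw [map_smul, Finsupp.smul_apply, smul_eq_mul, mul_comm]
    rfl
  rw [hdet, mul_pow, det_sq_of_transpose_mul_self hPP, det_sq_of_transpose_mul_self hRR]
  simp

/-- The frame with its last three vectors scaled by √λ. Existence excludes the default value 0 of
`poppDensity`. -/
theorem exists_isPoppBasis (z : S7) : ∃ E, S7T.IsPoppBasis z E := by
  have hl := poppFactor_pos z
  set w : Fin 7 → ℝˣ := Fin.append (fun _ : Fin 4 => 1)
    (fun _ : Fin 3 => Units.mk0 (Real.sqrt (poppFactor z)) (Real.sqrt_pos.2 hl).ne') with hw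
  set E := (tangentBasis z).unitsSMul w with hE
  have hcast : ∀ i : Fin 7, i.val < 4 → ∃ j : Fin 4, i = Fin.castAdd 3 j := fun i hi =>
    ⟨⟨i, hi⟩, rfl⟩
  have hE1 : ∀ j : Fin 4, E (Fin.castAdd 3 j) = canonicalField (Fin.castAdd 3 j) z := fun j => by
    rw [hE, Module.Basis.unitsSMul_apply, hw, Fin.append_left, one_smul, tangentBasis_apply]
  have hE2 : ∀ k : Fin 3, E (Fin.natAdd 4 k) =
      Real.sqrt (poppFactor z) • canonicalField (Fin.natAdd 4 k) z := fun k => by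
    rw [hE, Module.Basis.unitsSMul_apply, hw, Fin.append_right, tangentBasis_apply]
    rfl
  refine ⟨E, fun i hi => ?_, fun i j hi hj => ?_, fun c => ?_⟩
  · obtain ⟨j, rfl⟩ := hcast i hi
    rw [hE1]
    exact canonicalField_mem_distT z j
  · change inner ℝ (dIncl z (E i)) (dIncl z (E j)) = _
    obtain ⟨i, rfl⟩ := hcast i hi
    obtain ⟨j, rfl⟩ := hcast j hj
    rw [hE1, hE1, dIncl_canonicalField, dIncl_canonicalField, inner_cliffA_sphere]
  · rw [sum_filter_four_le, sum_filter_four_le]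
    have h : ∑ k : Fin 3, c (Fin.natAdd 4 k) • (S7T.dist z).mkQ (E (Fin.natAdd 4 k)) =
        ∑ k : Fin 3, (c (Fin.natAdd 4 k) * Real.sqrt (poppFactor z)) •
          (distT z).mkQ (canonicalField (Fin.natAdd 4 k) z) := by
      refine Finset.sum_congr rfl fun k _ => ?_
      rw [hE2, mul_smul]
      exact congrArg _ (map_smul (distT z).mkQ _ _)
    refine (congrArg (S7T.quotNormSq z) h).trans ((quotNormSq_sum z _).trans ?_)
    simp only [mul_pow, Real.sq_sqrt hl.le, ← Finset.sum_mul]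
    exact mul_div_cancel_right₀ _ hl.ne'

theorem poppDensity_eq (z : S7) (v : Fin 7 → TangentSpace (𝓡 7) z) :
    S7T.poppDensity z v = poppFactor z ^ (-(3 / 2) : ℝ) * |(tangentBasis z).det v| := by
  have hl := poppFactor_pos z
  have hex := exists_isPoppBasis z
  rw [SubRiemannian.poppDensity, dif_pos hex]
  set E := hex.choose with hE
  have h1 := sq_det_tangentBasis_of_isPoppBasis hex.choose_spec
  rw [← hE] at h1
  have h2 : (tangentBasis z).det v = (tangentBasis z).det E * E.det v := by
    rw [Module.Basis.det_apply, Module.Basis.det_apply, Module.Basis.det_apply, ← Matrix.det_mul,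
      Module.Basis.toMatrix_mul_toMatrix]
  have h3 : |(tangentBasis z).det E| = poppFactor z ^ (3 / 2 : ℝ) := by
    rw [← abs_of_nonneg (Real.rpow_nonneg hl.le (3 / 2 : ℝ)), ← sq_eq_sq_iff_abs_eq_abs, h1,
      ← Real.rpow_natCast (_ ^ (3 / 2 : ℝ)), ← Real.rpow_mul hl.le, ← Real.rpow_natCast]
    norm_num
  rw [h2, abs_mul, h3, ← mul_assoc, ← Real.rpow_add hl]
  norm_num

/-! ### The standard volume in charts, through polar coordinates. -/

/-- The linear map `(t, w) ↦ t z + ∑ w_a A_a z`. -/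
def frameMap (z : S7) : ℝ × EuclideanSpace ℝ (Fin 7) →ₗ[ℝ] E8 where
  toFun p := p.1 • (z : E8) + ∑ a, p.2 a • (cliffA a).toEuclideanLin (z : E8)
  map_add' p q := by
    simp only [Prod.fst_add, Prod.snd_add, PiLp.add_apply, add_smul, Finset.sum_add_distrib]
    abel
  map_smul' c p := by
    simp only [Prod.smul_fst, Prod.smul_snd, PiLp.smul_apply, smul_eq_mul, mul_smul, smul_add,
      Finset.smul_sum, RingHom.id_apply]

theorem frameMap_apply (z : S7) (p : ℝ × EuclideanSpace ℝ (Fin 7)) :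
    frameMap z p = p.1 • (z : E8) + ∑ a, p.2 a • (cliffA a).toEuclideanLin (z : E8) := rfl

theorem norm_frameMap_sq (z : S7) (p : ℝ × EuclideanSpace ℝ (Fin 7)) :
    ‖frameMap z p‖ ^ 2 = ‖p.1‖ ^ 2 + ‖p.2‖ ^ 2 := by
  have hz : inner ℝ (z : E8) (z : E8) = 1 := by
    rw [real_inner_self_eq_norm_sq, norm_eq_of_mem_sphere z, one_pow]
  have h1 : ∀ a, inner ℝ ((cliffA a).toEuclideanLin (z : E8)) (z : E8) = 0 := fun a => by
    rw [real_inner_comm, inner_cliffA_self]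
  rw [← real_inner_self_eq_norm_sq, frameMap_apply, EuclideanSpace.norm_sq_eq]
  simp only [inner_add_left, inner_add_right, real_inner_smul_left, real_inner_smul_right,
    inner_sum, sum_inner, inner_cliffA_sphere, h1, inner_cliffA_self, hz]
  simp [pow_two]

/-- `frameMap z` as a linear isometry of `ℝ × ℝ⁷` with the Euclidean norm. -/
def frameIsometry (z : S7) : WithLp 2 (ℝ × EuclideanSpace ℝ (Fin 7)) ≃ₗᵢ[ℝ] E8 :=
  LinearIsometry.toLinearIsometryEquiv
    { toLinearMap := (frameMap z).comp (WithLp.linearEquiv 2 ℝ _).toLinearMap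
      norm_map' := fun p => by
        rw [← sq_eq_sq₀ (norm_nonneg _) (norm_nonneg _), WithLp.prod_norm_sq_eq_of_L2]
        exact norm_frameMap_sq z _ }
    (by
      rw [(WithLp.linearEquiv 2 ℝ (ℝ × EuclideanSpace ℝ (Fin 7))).finrank_eq]
      simp)

/-- `frameMap z` as a linear equivalence. -/
def frameEquiv (z : S7) : (ℝ × EuclideanSpace ℝ (Fin 7)) ≃L[ℝ] E8 :=
  ((WithLp.linearEquiv 2 ℝ (ℝ × EuclideanSpace ℝ (Fin 7))).symm.trans
    (frameIsometry z).toLinearEquiv).toContinuousLinearEquiv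

theorem frameEquiv_apply (z : S7) (p : ℝ × EuclideanSpace ℝ (Fin 7)) :
    frameEquiv z p = frameMap z p := rfl

/-- The plain product carries the sup norm, so the isometry is composed with the volume-preserving
passage to the `L²` product. -/
theorem measurePreserving_frameEquiv (z : S7) :
    MeasurePreserving (frameEquiv z) volume volume :=
  (frameIsometry z).measurePreserving.comp (WithLp.volume_preserving_toLp ℝ
    (EuclideanSpace ℝ (Fin 7)))

/-- Compare the measures of the unit ball, which is positive and finite. -/
theorem abs_det_of_measurePreserving {E : Type*} [NormedAddCommGroup E] [NormedSpace ℝ E]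
    [FiniteDimensional ℝ E] [MeasurableSpace E] [BorelSpace E] (μ : Measure E)
    [μ.IsAddHaarMeasure] (f : E →ₗ[ℝ] E) (hdet : LinearMap.det f ≠ 0)
    (hf : MeasurePreserving f μ μ) : |LinearMap.det f| = 1 := by
  have h := Measure.map_linearMap_addHaar_eq_smul_addHaar μ hdet
  rw [hf.map_eq] at h
  have h1 := congrArg (fun ν : Measure E => ν (Metric.ball 0 1)) h
  simp only [Measure.smul_apply, smul_eq_mul] at h1
  have hpos : μ (Metric.ball 0 1) ≠ 0 := (Metric.measure_ball_pos μ 0 one_pos).ne'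
  have hfin : μ (Metric.ball 0 1) ≠ ⊤ := measure_ball_lt_top.ne
  have h2 : ENNReal.ofReal |(LinearMap.det f)⁻¹| = 1 := by
    have : 1 * μ (Metric.ball 0 1) = ENNReal.ofReal |(LinearMap.det f)⁻¹| * μ (Metric.ball 0 1) := by
      rw [one_mul]; exact h1
    exact ((ENNReal.mul_left_inj hpos hfin).1 this).symm
  rw [ENNReal.ofReal_eq_one, abs_inv, inv_eq_one] at h2
  exact h2

instance isAddHaarMeasure_volume_prod :
    (volume : Measure (ℝ × EuclideanSpace ℝ (Fin 7))).IsAddHaarMeasure :=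
  inferInstanceAs
    ((volume : Measure ℝ).prod (volume : Measure (EuclideanSpace ℝ (Fin 7)))).IsAddHaarMeasure

/-- Lets the polar map be read in one fixed frame at `z₀` while its differential is computed in the
moving frame. -/
theorem abs_det_frameEquiv (z z₀ : S7) :
    |LinearMap.det ((frameEquiv z).trans (frameEquiv z₀).symm).toLinearEquiv.toLinearMap| = 1 := by
  refine abs_det_of_measurePreserving (volume : Measure (ℝ × EuclideanSpace ℝ (Fin 7))) _
    (LinearEquiv.isUnit_det' _).ne_zero ?_
  exact ((measurePreserving_frameEquiv z₀).symm
    (frameEquiv z₀).toHomeomorph.toMeasurableEquiv).comp (measurePreserving_frameEquiv z)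

/-- The Jacobian of a parametrization `f` of `S⁷`: the determinant of its differential with respect
to the orthonormal frame `A_1 z, …, A_7 z`. -/
def sphereJacobian (f : EuclideanSpace ℝ (Fin 7) → S7) (u : EuclideanSpace ℝ (Fin 7)) : ℝ :=
  (Matrix.of fun a i : Fin 7 => inner ℝ ((cliffA a).toEuclideanLin (f u : E8))
    (fderiv ℝ (fun p => (f p : E8)) u (EuclideanSpace.single i (1 : ℝ)))).det

theorem sphereJacobian_eq {f : EuclideanSpace ℝ (Fin 7) → S7} {u : EuclideanSpace ℝ (Fin 7)}
    (hf : MDifferentiableAt (𝓡 7) (𝓡 7) f u) :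
    sphereJacobian f u = (tangentBasis (f u)).det fun i =>
      mfderiv (𝓡 7) (𝓡 7) f u (EuclideanSpace.single i (1 : ℝ)) := by
  rw [Module.Basis.det_apply, sphereJacobian]
  congr 1
  ext a i
  rw [Matrix.of_apply, fderiv_coe_comp hf, ← tangentBasis_repr]
  rfl

/-- The differential of a parametrization of `S⁷` in the orthonormal frame. -/
def frameDeriv (f : EuclideanSpace ℝ (Fin 7) → S7) (u : EuclideanSpace ℝ (Fin 7)) :
    EuclideanSpace ℝ (Fin 7) →ₗ[ℝ] EuclideanSpace ℝ (Fin 7) :=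
  (WithLp.linearEquiv 2 ℝ (Fin 7 → ℝ)).symm.toLinearMap.comp
    (LinearMap.pi fun a => (innerₗ E8 ((cliffA a).toEuclideanLin (f u : E8))).comp
      (fderiv ℝ (fun p => (f p : E8)) u).toLinearMap)

theorem frameDeriv_apply (f : EuclideanSpace ℝ (Fin 7) → S7) (u w : EuclideanSpace ℝ (Fin 7))
    (a : Fin 7) : frameDeriv f u w a = inner ℝ ((cliffA a).toEuclideanLin (f u : E8))
      (fderiv ℝ (fun p => (f p : E8)) u w) := rfl

theorem det_frameDeriv (f : EuclideanSpace ℝ (Fin 7) → S7) (u : EuclideanSpace ℝ (Fin 7)) :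
    LinearMap.det (frameDeriv f u) = sphereJacobian f u := by
  rw [← LinearMap.det_toMatrix (EuclideanSpace.basisFun (Fin 7) ℝ).toBasis, sphereJacobian]
  congr 1

theorem fderiv_coe_eq_frameMap {f : EuclideanSpace ℝ (Fin 7) → S7} {u : EuclideanSpace ℝ (Fin 7)}
    (hf : MDifferentiableAt (𝓡 7) (𝓡 7) f u) (w : EuclideanSpace ℝ (Fin 7)) :
    fderiv ℝ (fun p => (f p : E8)) u w = frameMap (f u) (0, frameDeriv f u w) := by
  rw [frameMap_apply, zero_smul, zero_add]
  simp only [frameDeriv_apply]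
  rw [fderiv_coe_comp hf]
  conv_lhs => rw [← (tangentBasis (f u)).sum_repr (mfderiv (𝓡 7) (𝓡 7) f u w)]
  rw [map_sum]
  refine Finset.sum_congr rfl fun a _ => ?_
  rw [map_smul, tangentBasis_apply, dIncl_canonicalField, tangentBasis_repr]

/-- The polar map `(r, u) ↦ r f(u)`, read in `ℝ × ℝ⁷`. -/
def polarMap (f : EuclideanSpace ℝ (Fin 7) → S7) (z₀ : S7)
    (p : ℝ × EuclideanSpace ℝ (Fin 7)) : ℝ × EuclideanSpace ℝ (Fin 7) :=
  (frameEquiv z₀).symm (p.1 • (f p.2 : E8))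

/-- In the moving frame the differential is `id × r · frameDeriv f u`. The scalar `r` acts on seven
dimensions, giving `r^7`. -/
theorem hasFDerivAt_polarMap {f : EuclideanSpace ℝ (Fin 7) → S7} (z₀ : S7)
    {p : ℝ × EuclideanSpace ℝ (Fin 7)} (hf : MDifferentiableAt (𝓡 7) (𝓡 7) f p.2)
    (hd : DifferentiableAt ℝ (fun u => (f u : E8)) p.2) :
    ∃ L : ℝ × EuclideanSpace ℝ (Fin 7) →L[ℝ] ℝ × EuclideanSpace ℝ (Fin 7),
      HasFDerivAt (polarMap f z₀) L p ∧ |L.det| = |p.1 ^ 7 * sphereJacobian f p.2| := by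
  have h1 : HasFDerivAt (fun p : ℝ × EuclideanSpace ℝ (Fin 7) => p.1 • (f p.2 : E8)) _ p :=
    (hasFDerivAt_fst (𝕜 := ℝ) (p := p)).smul (hd.hasFDerivAt.comp p hasFDerivAt_snd)
  have h2 := (frameEquiv z₀).symm.toContinuousLinearMap.hasFDerivAt.comp p h1
  refine ⟨_, h2, ?_⟩
  have h3 : ∀ L : ℝ × EuclideanSpace ℝ (Fin 7) →L[ℝ] ℝ × EuclideanSpace ℝ (Fin 7),
      L.toLinearMap = ((frameEquiv (f p.2)).trans (frameEquiv z₀).symm).toLinearEquiv.toLinearMap ∘ₗ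
        (LinearMap.prodMap (LinearMap.id) (p.1 • frameDeriv f p.2)) →
      |L.det| = |p.1 ^ 7 * sphereJacobian f p.2| := by
    intro L hL
    rw [ContinuousLinearMap.det, hL, LinearMap.det_comp, abs_mul, abs_det_frameEquiv, one_mul,
      LinearMap.det_prodMap, LinearMap.det_id, one_mul, LinearMap.det_smul, det_frameDeriv,
      finrank_euclideanSpace_fin]
  refine h3 _ (LinearMap.ext fun q => ?_)
  refine congrArg (frameEquiv z₀).symm ?_
  have h4 : frameEquiv (f p.2) (q.1, p.1 • frameDeriv f p.2 q.2) =
      q.1 • (f p.2 : E8) + p.1 • frameMap (f p.2) (0, frameDeriv f p.2 q.2) := by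
    rw [frameEquiv_apply, ← map_smul, frameMap_apply, frameMap_apply]
    simp [Finset.smul_sum, mul_smul]
  refine Eq.trans ?_ h4.symm
  rw [← fderiv_coe_eq_frameMap hf]
  simp [add_comm]

section Chart

variable {φ : OpenPartialHomeomorph S7 (EuclideanSpace ℝ (Fin 7))}

theorem mdifferentiableAt_chart_symm (hφ : φ ∈ IsManifold.maximalAtlas (𝓡 7) ∞ S7)
    {u : EuclideanSpace ℝ (Fin 7)} (hu : u ∈ φ.target) :
    MDifferentiableAt (𝓡 7) (𝓡 7) φ.symm u :=
  ((contMDiffOn_symm_of_mem_maximalAtlas hφ).contMDiffAt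
    (φ.open_target.mem_nhds hu)).mdifferentiableAt (by simp)

theorem contDiffOn_coe_chart_symm (hφ : φ ∈ IsManifold.maximalAtlas (𝓡 7) ∞ S7) :
    ContDiffOn ℝ ∞ (fun p => (φ.symm p : E8)) φ.target :=
  ((contMDiff_coe_sphere (E := E8) (n := 7) (m := ∞)).comp_contMDiffOn
    (contMDiffOn_symm_of_mem_maximalAtlas hφ)).contDiffOn

theorem continuousOn_matrix_det {X ι : Type*} [TopologicalSpace X] [Fintype ι] [DecidableEq ι]
    {F : X → Matrix ι ι ℝ} {s : Set X} (h : ∀ a i, ContinuousOn (fun x => F x a i) s) :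
    ContinuousOn (fun x => (F x).det) s :=
  (continuous_id.matrix_det).comp_continuousOn
    (continuousOn_pi.2 fun a => continuousOn_pi.2 fun i => h a i)

theorem continuousOn_sphereJacobian (hφ : φ ∈ IsManifold.maximalAtlas (𝓡 7) ∞ S7) :
    ContinuousOn (sphereJacobian φ.symm) φ.target := by
  have h1 := contDiffOn_coe_chart_symm hφ
  have h2 : ContinuousOn (fderiv ℝ (fun p => (φ.symm p : E8))) φ.target :=
    h1.continuousOn_fderiv_of_isOpen φ.open_target (by simp)
  refine continuousOn_matrix_det fun a i => ?_
  exact ((cliffA a).toEuclideanLin.toContinuousLinearMap.continuous.comp_continuousOn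
    h1.continuousOn).inner (h2.clm_apply continuousOn_const)

theorem measurableSet_chart_preimage {s : Set S7} (hs : MeasurableSet s) :
    MeasurableSet (φ.target ∩ φ.symm ⁻¹' s) := by
  have h : φ.target ∩ φ.symm ⁻¹' s = Subtype.val '' ((fun u : φ.target => φ.symm u) ⁻¹' s) := by
    ext u
    simp [and_comm]
  rw [h]
  exact φ.open_target.measurableSet.subtype_image
    ((continuousOn_iff_continuous_domRestrict.1 φ.continuousOn_symm).measurable hs)

open scoped Pointwise in
theorem image_polarMap (z₀ : S7) {s : Set S7} (hs : s ⊆ φ.source) :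
    polarMap φ.symm z₀ '' (Set.Ioo (0 : ℝ) 1 ×ˢ (φ.target ∩ φ.symm ⁻¹' s)) =
      frameEquiv z₀ ⁻¹' (Set.Ioo (0 : ℝ) 1 • ((↑) '' s : Set E8)) := by
  ext p
  constructor
  · rintro ⟨⟨r, u⟩, ⟨hr, hu⟩, rfl⟩
    refine ⟨r, hr, (φ.symm u : E8), ⟨_, hu.2, rfl⟩, ?_⟩
    simp [polarMap]
  · rintro ⟨r, hr, _, ⟨w, hw, rfl⟩, hp⟩
    refine ⟨(r, φ w), ⟨hr, φ.map_source (hs hw), ?_⟩, ?_⟩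
    · rw [Set.mem_preimage, φ.left_inv (hs hw)]
      exact hw
    · simp only [polarMap, φ.left_inv (hs hw)]
      rw [ContinuousLinearEquiv.symm_apply_eq]
      exact hp

theorem injOn_polarMap (z₀ : S7) :
    Set.InjOn (polarMap φ.symm z₀) (Set.Ioo (0 : ℝ) 1 ×ˢ φ.target) := by
  rintro ⟨r, u⟩ ⟨hr, hu⟩ ⟨r', u'⟩ ⟨hr', hu'⟩ h
  have h1 : r • (φ.symm u : E8) = r' • (φ.symm u' : E8) := (frameEquiv z₀).symm.injective h
  have h2 : ‖r • (φ.symm u : E8)‖ = ‖r' • (φ.symm u' : E8)‖ := congrArg norm h1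
  rw [norm_smul, norm_smul, norm_eq_of_mem_sphere, norm_eq_of_mem_sphere, mul_one, mul_one,
    Real.norm_of_nonneg (le_of_lt hr.1), Real.norm_of_nonneg (le_of_lt hr'.1)] at h2
  change r = r' at h2
  rw [← h2] at h1
  have h3 := Subtype.ext (smul_right_injective E8 hr.1.ne' h1)
  exact Prod.ext h2 (φ.symm.injOn hu hu' h3)

theorem lintegral_Ioo_pow (n : ℕ) :
    ∫⁻ r in Set.Ioo (0 : ℝ) 1, ENNReal.ofReal (r ^ n) = ENNReal.ofReal (1 / (n + 1)) := by
  rw [Measure.restrict_congr_set Ioo_ae_eq_Ioc, ← ofReal_integral_eq_lintegral_ofReal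
    (intervalIntegral.intervalIntegrable_pow _).1, ← intervalIntegral.integral_of_le zero_le_one]
  · simp
  · filter_upwards [ae_restrict_mem measurableSet_Ioc] with y hy
    exact pow_nonneg hy.1.le _

theorem aemeasurable_sphereJacobian (hφ : φ ∈ IsManifold.maximalAtlas (𝓡 7) ∞ S7) {s : Set S7}
    (hs : MeasurableSet s) : AEMeasurable (fun u => ENNReal.ofReal |sphereJacobian φ.symm u|)
      (volume.restrict (φ.target ∩ φ.symm ⁻¹' s)) :=
  ((((continuousOn_sphereJacobian hφ).mono Set.inter_subset_left).aemeasurable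
    (measurableSet_chart_preimage hs)).norm).ennreal_ofReal

/-- By definition `sigma7 s` is 8 times the volume of the cone `(0,1) · s`, which is the injective
image of `(0,1) × t` under the polar map. Change of variables and Tonelli split off the radial
integral of `r^7`. -/
theorem sigma7_eq_lintegral_chart (hφ : φ ∈ IsManifold.maximalAtlas (𝓡 7) ∞ S7) {s : Set S7}
    (hs : MeasurableSet s) (hsφ : s ⊆ φ.source) :
    sigma7 s = ∫⁻ u in φ.target ∩ φ.symm ⁻¹' s, ENNReal.ofReal |sphereJacobian φ.symm u| := by
  rcases s.eq_empty_or_nonempty with rfl | ⟨z₀, -⟩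
  · simp
  set t := φ.target ∩ φ.symm ⁻¹' s with ht
  have hmt : MeasurableSet t := measurableSet_chart_preimage hs
  have hder : ∀ p : ℝ × EuclideanSpace ℝ (Fin 7), p.2 ∈ φ.target →
      ∃ L : ℝ × EuclideanSpace ℝ (Fin 7) →L[ℝ] ℝ × EuclideanSpace ℝ (Fin 7),
        HasFDerivAt (polarMap φ.symm z₀) L p ∧
          |L.det| = |p.1 ^ 7 * sphereJacobian φ.symm p.2| := fun p hp =>
    hasFDerivAt_polarMap z₀ (mdifferentiableAt_chart_symm hφ hp)
      (((contDiffOn_coe_chart_symm hφ).contDiffAt (φ.open_target.mem_nhds hp)).differentiableAt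
        (by simp))
  choose! L hL hLdet using hder
  have hcv := lintegral_abs_det_fderiv_eq_addHaar_image
    (volume : Measure (ℝ × EuclideanSpace ℝ (Fin 7)))
    (measurableSet_Ioo.prod hmt : MeasurableSet (Set.Ioo (0 : ℝ) 1 ×ˢ t))
    (fun p hp => (hL p hp.2.1).hasFDerivWithinAt)
    ((injOn_polarMap z₀).mono (Set.prod_mono le_rfl Set.inter_subset_left))
  rw [image_polarMap z₀ hsφ, (measurePreserving_frameEquiv z₀).measure_preimage_emb
    (frameEquiv z₀).toHomeomorph.measurableEmbedding] at hcv
  have hint : ∫⁻ p in Set.Ioo (0 : ℝ) 1 ×ˢ t, ENNReal.ofReal |(L p).det| =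
      ∫⁻ p in Set.Ioo (0 : ℝ) 1 ×ˢ t,
        ENNReal.ofReal (p.1 ^ 7) * ENNReal.ofReal |sphereJacobian φ.symm p.2| := by
    refine setLIntegral_congr_fun (measurableSet_Ioo.prod hmt) fun p hp => ?_
    rw [hLdet p hp.2.1, abs_mul, abs_of_pos (pow_pos hp.1.1 7),
      ENNReal.ofReal_mul (pow_pos hp.1.1 7).le]
  rw [hint, Measure.volume_eq_prod, ← Measure.prod_restrict,
    lintegral_prod_mul (f := fun r : ℝ => ENNReal.ofReal (r ^ 7))
      (g := fun u => ENNReal.ofReal |sphereJacobian φ.symm u|) (by fun_prop)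
      (aemeasurable_sphereJacobian hφ hs), lintegral_Ioo_pow] at hcv
  rw [sigma7, Measure.toSphere_apply' _ hs, ← hcv, ← mul_assoc]
  -- The radial integral `1/8` cancels the dimension factor in the cone definition.
  have h8 : (Module.finrank ℝ E8 : ℝ≥0∞) * ENNReal.ofReal (1 / ((7 : ℕ) + 1)) = 1 := by
    rw [show Module.finrank ℝ E8 = 8 by simp, ← ENNReal.ofReal_natCast, ← ENNReal.ofReal_mul
      (by positivity)]
    norm_num
  rw [h8, one_mul]

/-- Upgrades the formula for sets to an identity of measures, from which integrals of functions
follow. -/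
theorem restrict_sigma7_eq_map (hφ : φ ∈ IsManifold.maximalAtlas (𝓡 7) ∞ S7) {s : Set S7}
    (hs : MeasurableSet s) (hsφ : s ⊆ φ.source) :
    sigma7.restrict s = ((volume.restrict (φ.target ∩ φ.symm ⁻¹' s)).withDensity
      fun u => ENNReal.ofReal |sphereJacobian φ.symm u|).map φ.symm := by
  have hm : AEMeasurable φ.symm ((volume.restrict (φ.target ∩ φ.symm ⁻¹' s)).withDensity
      fun u => ENNReal.ofReal |sphereJacobian φ.symm u|) :=
    ((φ.continuousOn_symm.mono Set.inter_subset_left).aemeasurable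
      (measurableSet_chart_preimage hs)).mono_ac (withDensity_absolutelyContinuous _ _)
  ext A hA
  rw [Measure.restrict_apply hA, sigma7_eq_lintegral_chart hφ (hA.inter hs)
    (Set.inter_subset_right.trans hsφ), Measure.map_apply_of_aemeasurable hm hA,
    withDensity_apply', Measure.restrict_restrict' (measurableSet_chart_preimage hs)]
  congr 2
  ext u
  simp only [Set.mem_inter_iff, Set.mem_preimage]
  tauto

theorem setLIntegral_sigma7 (hφ : φ ∈ IsManifold.maximalAtlas (𝓡 7) ∞ S7) {s : Set S7}
    (hs : MeasurableSet s) (hsφ : s ⊆ φ.source) {h : S7 → ℝ≥0∞} (hh : Measurable h) :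
    ∫⁻ z in s, h z ∂sigma7 = ∫⁻ u in φ.target ∩ φ.symm ⁻¹' s,
      ENNReal.ofReal |sphereJacobian φ.symm u| * h (φ.symm u) := by
  have hm : AEMeasurable φ.symm (volume.restrict (φ.target ∩ φ.symm ⁻¹' s)) :=
    (φ.continuousOn_symm.mono Set.inter_subset_left).aemeasurable
      (measurableSet_chart_preimage hs)
  rw [restrict_sigma7_eq_map hφ hs hsφ, lintegral_map' hh.aemeasurable
    (hm.mono_ac (withDensity_absolutelyContinuous _ _))]
  exact lintegral_withDensity_eq_lintegral_mul₀ (aemeasurable_sphereJacobian hφ hs)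
    (hh.comp_aemeasurable hm)

end Chart

/-! ### Uniqueness and identification of the Popp measure. -/

/-- The chart formula fixes the measure on each chart domain, and by second countability countably
many of these cover `M`. -/
theorem SubRiemannian.IsPoppMeasure.eq {n k : ℕ} {M : Type*} [TopologicalSpace M]
    [SecondCountableTopology M] [ChartedSpace (EuclideanSpace ℝ (Fin n)) M]
    [IsManifold (𝓡 n) ∞ M] [MeasurableSpace M] [BorelSpace M] {S : SubRiemannian n k M}
    {μ ν : Measure M} (hμ : S.IsPoppMeasure μ) (hν : S.IsPoppMeasure ν) : μ = ν := by
  obtain ⟨c, hc, hcov⟩ := TopologicalSpace.countable_cover_nhds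
    fun x : M => chart_source_mem_nhds (EuclideanSpace ℝ (Fin n)) x
  have h := (Measure.restrict_biUnion_congr (μ := μ) (ν := ν) hc).2 fun x _ => Measure.ext
    fun A hA => by
      have hx := IsManifold.chart_mem_maximalAtlas (I := 𝓡 n) (n := ∞) x
      have hA' := hA.inter (chartAt (EuclideanSpace ℝ (Fin n)) x).open_source.measurableSet
      rw [Measure.restrict_apply hA, Measure.restrict_apply hA,
        hμ _ hx _ hA' Set.inter_subset_right, hν _ hx _ hA' Set.inter_subset_right]
  rwa [hcov, Measure.restrict_univ, Measure.restrict_univ] at h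

theorem isPoppMeasure_S7T : S7T.IsPoppMeasure (sigma7.withDensity fun z =>
    ENNReal.ofReal (poppFactor z ^ (-(3 / 2) : ℝ))) := by
  intro φ hφ s hs hsφ
  have hcont : Continuous fun z : S7 => poppFactor z := by
    unfold poppFactor normSqX normSqY
    fun_prop
  have hmeas : Measurable fun z : S7 => ENNReal.ofReal (poppFactor z ^ (-(3 / 2) : ℝ)) :=
    (hcont.measurable.pow_const _).ennreal_ofReal
  rw [withDensity_apply _ hs, setLIntegral_sigma7 hφ hs hsφ hmeas]
  refine setLIntegral_congr_fun (measurableSet_chart_preimage hs) fun u hu => ?_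
  -- On coordinate fields the frame determinant is exactly the Jacobian in the chart formula for
  -- `sigma7`.
  rw [poppDensity_eq, ← sphereJacobian_eq (mdifferentiableAt_chart_symm hφ hu.1),
    ENNReal.ofReal_mul (Real.rpow_nonneg (poppFactor_pos _).le _), mul_comm]

end

theorem mainTheorem6 :
    S7T.IsStepTwo ∧
    (∀ z : S7, 0 < 16 * (1 - 2 * normSqX z * normSqY z)) ∧
    (∀ μ : Measure S7, S7T.IsPoppMeasure μ ↔
      μ = sigma7.withDensity fun z =>
        ENNReal.ofReal ((16 * (1 - 2 * normSqX z * normSqY z)) ^ (-(3 / 2) : ℝ))) ∧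
    ∀ z : S7, matrixBT z = (16 * (1 - 2 * normSqX z * normSqY z)) • (1 : Matrix (Fin 3) (Fin 3) ℝ) := by
  refine ⟨isStepTwo_S7T, poppFactor_pos, fun μ => ⟨fun h => h.eq isPoppMeasure_S7T, ?_⟩,
    fun z => ?_⟩
  · rintro rfl
    exact isPoppMeasure_S7T
  · ext k l
    simp only [matrixBT, Matrix.of_apply, structB_eq, sum_bracketCoeff_mul_bracketCoeff,
      Matrix.smul_apply, Matrix.one_apply, smul_eq_mul, mul_ite, mul_one, mul_zero]
    rfl
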